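/- Let $C$ be a finite set of candidates, $L$ a finite set of labels, and $\lambda\colon C\to 2^L$ a labeling; for $\ell\in L$ let $C_\ell=\{c\in C:\ell\in\lambda(c)\}$. Suppose that $\lambda$ is *1-laminar*: for any two distinct labels $x,y$, either $C_x\cap C_y=\emptyset$, or $C_x\subseteq C_y$, or $C_y\subseteq C_x$. Let $b_1,b_2\colon L\to\mathbb N$ be interval constraints: a committee $S\subseteq C$ is *diverse* if $b_1(\ell)\le |S\cap C_\ell|\le b_2(\ell)$ for every $\ell\in L$. Let $k\in\mathbb N$ be the desired committee size, let $w\colon C\to\mathbb R$ be a weight vector, and let $f(S)=\sum_{c\in S}w_c$ be the corresponding separable objective function. Let $\mathcal K$ be the family of all diverse committees of size $k$, and let $\overline{\mathcal K}=\{T : T\subseteq S\text{ for some }S\in\mathcal K\}$ be its lower extension. A *winning committee* is a $W\in\mathcal K$ with $f(W)=\max_{S\in\mathcal K}f(S)$; the problem DCWD (Diverse Committee Winner Determination) asks for one, or for the answer that $\mathcal K=\emptyset$. The *greedy algorithm* starts with $W=\emptyset$ and, while $|W|<k$, adds to $W$ some $y\in C\setminus W$ such that $W\cup\{y\}\in\overline{\mathcal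 K}$ and $f(W\cup\{y\})-f(W)$ is maximum among all such candidates. Then: 1. If $\mathcal K\neq\emptyset$, then $\overline{\mathcal K}$ is the family of independent sets of a matroid on $C$. 2. If $\mathcal K\ne\emptyset$, then, however ties are broken, the greedy algorithm never gets stuck before $|W|=k$, and the committee with $k$ members that it produces is a winning committee. 3. There is a single algorithm (a program for a random access machine with unit-cost addition, truncated subtraction, comparison and array access on natural numbers, which can access the real weights only by unit-cost comparisons of two of them) that gets as input $|C|$, $|L|$, $k$, for each candidate the list of its labels, $b_1$, $b_2$ and $w$, and that, on every such input with 1-laminar $\lambda$, halts and either correctly reports that $\mathcal K=\emptyset$ or outputs a winning committee, its members being listed in an order in which the greedy algorithm can select them. For $k\ge 1$ its running time is $$O\bigl(k^2\,|C|\,|L|+|C|\log|C|\bigr),$$ that is, at most $c\,(k^2|C||L|+|C|\log|C|+1)$ steps for an absolute constant $c$. -/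

import Mathlib

namespace DCWD

/-! ### Committees, labels, constraints, objective functions -/

/-- `C_ℓ`: the candidates that have label `l` under the labeling function `lab`. -/
def labelClass {C L : Type*} [Fintype C] [DecidableEq L] (lab : C → Finset L) (l : L) :
    Finset C :=
  Finset.univ.filter fun c => l ∈ lab c

/-- The labeling is 1-laminar: for any two distinct labels, their candidate sets are disjoint
or one contains the other. -/
def IsOneLaminar {C L : Type*} [Fintype C] [DecidableEq C] [DecidableEq L]
    (lab : C → Finset L) : Prop :=
  ∀ x y : L, x ≠ y →
    labelClass lab x ∩ labelClass lab y = ∅ ∨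
      labelClass lab x ⊆ labelClass lab y ∨ labelClass lab y ⊆ labelClass lab x

/-- The diversity specification given by the interval constraints `b₁`, `b₂`. -/
def intervalSpec {C L : Type*} [Fintype C] [DecidableEq C] [DecidableEq L]
    (lab : C → Finset L) (b₁ b₂ : L → ℕ) (S : Finset C) : Prop :=
  ∀ l : L, b₁ l ≤ (S ∩ labelClass lab l).card ∧ (S ∩ labelClass lab l).card ≤ b₂ l

/-- The separable objective function with weight vector `w`. -/
def separable {C : Type*} (w : C → ℝ) (S : Finset C) : ℝ := ∑ c ∈ S, w c

/-- `K_D`: the `D`-diverse committees of size `k`. -/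
def diverseCommittees {C : Type*} (D : Finset C → Prop) (k : ℕ) : Set (Finset C) :=
  {S | D S ∧ S.card = k}

/-- The lower extension of a family of sets: all subsets of its members. -/
def lowerExtension {C : Type*} (K : Set (Finset C)) : Set (Finset C) :=
  {T | ∃ S ∈ K, T ⊆ S}

/-- `W` solves the winner determination problem: it is a `D`-diverse committee of size `k` of
maximum value among all `D`-diverse committees of size `k`. -/
def IsWinningCommittee {C : Type*} (D : Finset C → Prop) (k : ℕ) (f : Finset C → ℝ)
    (W : Finset C) : Prop :=
  W ∈ diverseCommittees D k ∧ ∀ S ∈ diverseCommittees D k, f S ≤ f W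

/-! ### The greedy algorithm -/

/-- The greedy algorithm may add `y` to the current committee `W`: `y` is a new candidate such that
`W ∪ {y}` is still in the lower extension of `K`, and among all such candidates its marginal
contribution `f(W ∪ {y}) - f(W)` is maximum. -/
def IsGreedyChoice {C : Type*} [DecidableEq C] (K : Set (Finset C)) (f : Finset C → ℝ)
    (W : Finset C) (y : C) : Prop :=
  (y ∉ W ∧ insert y W ∈ lowerExtension K) ∧
    ∀ z, z ∉ W → insert z W ∈ lowerExtension K → f (insert z W) - f W ≤ f (insert y W) - f W

/-- `ys` lists, in order, the candidates added in a (partial) run of the greedy algorithm that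
starts from the empty committee. -/
def IsGreedyRun {C : Type*} [DecidableEq C] (K : Set (Finset C)) (f : Finset C → ℝ)
    (ys : List C) : Prop :=
  ∀ (i : ℕ) (hi : i < ys.length), IsGreedyChoice K f (ys.take i).toFinset ys[i]

/-! ### Machine model

A random access machine with unit costs. The memory consists of registers `reg 0, reg 1, …` and of
arrays `arr 0, arr 1, …`, all holding natural numbers; a program names only finitely many of them.
The arithmetic operations are addition and truncated subtraction only. The real weights sit in a
read-only input array, and the only thing a program can do with them is to compare two of them.
Every operation costs one step. Programs are structured (sequence, branching, loop). -/

/-- The memory of the machine. -/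
structure Mem where
  reg : ℕ → ℕ
  arr : ℕ → ℕ → ℕ

/-- Arithmetic expressions. -/
inductive Expr where
  | lit (v : ℕ)
  | reg (r : ℕ)
  | get (a : ℕ) (i : Expr)
  | add (x y : Expr)
  | sub (x y : Expr)

/-- The value of an expression. -/
def Expr.eval (s : Mem) : Expr → ℕ
  | .lit v => v
  | .reg r => s.reg r
  | .get a i => s.arr a (i.eval s)
  | .add x y => x.eval s + y.eval s
  | .sub x y => x.eval s - y.eval s

/-- The number of steps for evaluating an expression: one for each operation in it. -/
def Expr.cost : Expr → ℕ
  | .lit _ => 1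
  | .reg _ => 1
  | .get _ i => i.cost + 1
  | .add x y => x.cost + y.cost + 1
  | .sub x y => x.cost + y.cost + 1

/-- Tests. The test `wle x y` compares two entries of the array of real weights. -/
inductive Test where
  | lt (x y : Expr)
  | eq (x y : Expr)
  | wle (x y : Expr)
  | not (b : Test)
  | and (b c : Test)

/-- The truth value of a test, where `wt` is the array of real weights. -/
def Test.holds (wt : ℕ → ℝ) (s : Mem) : Test → Prop
  | .lt x y => x.eval s < y.eval s
  | .eq x y => x.eval s = y.eval s
  | .wle x y => wt (x.eval s) ≤ wt (y.eval s)
  | .not b => ¬ b.holds wt s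
  | .and b c => b.holds wt s ∧ c.holds wt s

/-- The number of steps for evaluating a test. -/
def Test.cost : Test → ℕ
  | .lt x y => x.cost + y.cost + 1
  | .eq x y => x.cost + y.cost + 1
  | .wle x y => x.cost + y.cost + 1
  | .not b => b.cost + 1
  | .and b c => b.cost + c.cost + 1

/-- Programs. -/
inductive Prog where
  | skip
  | assign (r : ℕ) (e : Expr)
  | store (a : ℕ) (i e : Expr)
  | seq (p q : Prog)
  | ite (b : Test) (p q : Prog)
  | loop (b : Test) (p : Prog)

/-- `Exec wt p s s' t`: the program `p`, started in memory `s`, halts in memory `s'` after exactly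
`t` steps. (Execution is deterministic; `loop b p` repeats `p` as long as `b` holds.) -/
inductive Exec (wt : ℕ → ℝ) : Prog → Mem → Mem → ℕ → Prop where
  | skip (s : Mem) : Exec wt .skip s s 1
  | assign (r : ℕ) (e : Expr) (s : Mem) :
      Exec wt (.assign r e) s ⟨Function.update s.reg r (e.eval s), s.arr⟩ (e.cost + 1)
  | store (a : ℕ) (i e : Expr) (s : Mem) :
      Exec wt (.store a i e) s
        ⟨s.reg, Function.update s.arr a (Function.update (s.arr a) (i.eval s) (e.eval s))⟩
        (i.cost + e.cost + 1)
  | seq {p q : Prog} {s s' s'' : Mem} {t t' : ℕ} :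
      Exec wt p s s' t → Exec wt q s' s'' t' → Exec wt (.seq p q) s s'' (t + t')
  | iteTrue {b : Test} {p q : Prog} {s s' : Mem} {t : ℕ} :
      b.holds wt s → Exec wt p s s' t → Exec wt (.ite b p q) s s' (b.cost + 1 + t)
  | iteFalse {b : Test} {p q : Prog} {s s' : Mem} {t : ℕ} :
      ¬ b.holds wt s → Exec wt q s s' t → Exec wt (.ite b p q) s s' (b.cost + 1 + t)
  | loopTrue {b : Test} {p : Prog} {s s' s'' : Mem} {t t' : ℕ} :
      b.holds wt s → Exec wt p s s' t → Exec wt (.loop b p) s' s'' t' →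
        Exec wt (.loop b p) s s'' (b.cost + 1 + t + t')
  | loopFalse {b : Test} {p : Prog} {s : Mem} :
      ¬ b.holds wt s → Exec wt (.loop b p) s s (b.cost + 1)

/-! ### Problem instances and their encoding -/

/-- An instance with interval constraints and a separable objective function. The labeling is given
by listing, for every candidate, its labels (in any order, without repetition). -/
structure Instance where
  numCands : ℕ
  numLabels : ℕ
  labelList : Fin numCands → List (Fin numLabels)
  nodup : ∀ c, (labelList c).Nodup
  lower : Fin numLabels → ℕ
  upper : Fin numLabels → ℕ
  size : ℕ
  weight : Fin numCands → ℝ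

namespace Instance

/-- The labeling function. -/
def lab (I : Instance) (c : Fin I.numCands) : Finset (Fin I.numLabels) :=
  (I.labelList c).toFinset

/-- The diversity specification. -/
def spec (I : Instance) : Finset (Fin I.numCands) → Prop :=
  intervalSpec I.lab I.lower I.upper

/-- The objective function. -/
noncomputable def obj (I : Instance) : Finset (Fin I.numCands) → ℝ :=
  separable I.weight

/-- The input arrays: array `1` holds the concatenation of the label lists of the candidates
`0, 1, …`, array `0` holds the positions at which the lists start (and, last, the total length),
and arrays `2` and `3` hold the lower and upper bounds. -/
def inputArray (I : Instance) : ℕ → List ℕ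
  | 0 => (List.range (I.numCands + 1)).map fun i =>
      ((List.ofFn I.labelList).take i).flatten.length
  | 1 => (List.ofFn I.labelList).flatten.map Fin.val
  | 2 => (List.ofFn I.lower)
  | 3 => (List.ofFn I.upper)
  | _ => []

/-- The initial memory: registers `0`, `1`, `2` hold `|C|`, `|L|`, `k`, the arrays hold the input
arrays, and everything else is `0`. -/
def initMem (I : Instance) : Mem where
  reg r := [I.numCands, I.numLabels, I.size].getD r 0
  arr a i := (I.inputArray a).getD i 0

/-- The array of real weights (padded with zeros). -/
noncomputable def weightArray (I : Instance) (i : ℕ) : ℝ :=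
  (List.ofFn I.weight).getD i 0

/-- The final memory `s` holds a correct answer: if there is no diverse committee of the desired
size, register `0` holds `0`; otherwise register `0` holds `1`, and the first `k` entries of array
`0` list the candidates of a winning committee, in an order in which the greedy algorithm can
select them. -/
def CorrectAnswer (I : Instance) (s : Mem) : Prop :=
  (diverseCommittees I.spec I.size = ∅ ∧ s.reg 0 = 0) ∨
    (s.reg 0 = 1 ∧ ∃ ys : List (Fin I.numCands),
      (List.range I.size).map (s.arr 0) = ys.map Fin.val ∧
        IsGreedyRun (diverseCommittees I.spec I.size) I.obj ys ∧
        IsWinningCommittee I.spec I.size I.obj ys.toFinset)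

end Instance

end DCWD

set_option linter.unusedSectionVars false

namespace DCWD

/-! ### Laminar families with interval constraints -/

/-! Treat the size `k` as one more interval constraint, with both bounds equal to `k`, on a root
class containing every candidate. The family of classes stays laminar, and the diverse committees of
size `k` become `boundedSets` of a laminar family with a rigid root.

`boundedSets_exchange` is basis exchange. Given `x ∈ S \ S'`, take the smallest class `X` around `x`
that is at its lower bound in `S` (the root qualifies), and remove from it all classes inside `X`
that avoid `x` and are at their upper bound in `S`. By laminarity `S'` has no more elements than `S`
in the removed part, hence no fewer in the rest. As `x` lies in the rest but not in `S'`, some `y ∈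
S' \ S` lies there too, and nestedness shows that exchanging `x` for `y` violates no bound. So a
nonempty family of committees is the family of bases of a matroid, and the greedy algorithm is
correct because at every stage some optimal basis contains the chosen elements.

The program has no direct test for the lower extension, but it can test whether a list of `k`
candidates is a diverse committee by recounting labels in time `O(k |L|)`. Two facts make this
enough. A first committee is built by always serving a smallest deficient class: any candidate of
that class that keeps the upper bounds is safe (`exists_boundedSets_insert`). After that, a complete
committee is kept whose first `m` members are the greedy choices; by `HasExchange.exists_swap` a new
candidate can be added to these choices exactly when it can replace one of the other members.
Rejected candidates stay rejected, so one pass by decreasing weight suffices.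

Both phases make at most `k |C|` trials, and merge sort supplies `|C| log |C|`. Without labels the
bound leaves no room for these trials, but then the `k` heaviest candidates are the answer.

Memory: array `4` holds the sorted candidates, `5` is the merge buffer, `6` the current list or
committee, `7` the label counts, `8` the class sizes. -/

/-- Any two members of the family are disjoint or nested. -/
def LaminarFamily {C ι : Type*} (F : ι → Finset C) : Prop :=
  ∀ x y, Disjoint (F x) (F y) ∨ F x ⊆ F y ∨ F y ⊆ F x

/-- The sets that meet every member of the family in a number of elements between the bounds. -/
def boundedSets {C ι : Type*} [DecidableEq C] (F : ι → Finset C) (lo hi : ι → ℕ) :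
    Set (Finset C) :=
  {S | ∀ i, lo i ≤ (S ∩ F i).card ∧ (S ∩ F i).card ≤ hi i}

section Laminar

variable {C ι : Type*} [DecidableEq C] {F : ι → Finset C} {lo hi : ι → ℕ}

theorem LaminarFamily.nested (hF : LaminarFamily F) {x y : ι} {c : C} (hx : c ∈ F x)
    (hy : c ∈ F y) : F x ⊆ F y ∨ F y ⊆ F x :=
  (hF x y).resolve_left fun h => Finset.disjoint_left.1 h hx hy

/-- An additive form without subtraction: the effect of an exchange on one class then reduces to
linear arithmetic over four cases. -/
theorem card_insert_erase_inter {S : Finset C} {x y : C} (hx : x ∈ S) (hy : y ∉ S)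
    (Z : Finset C) :
    (insert y (S.erase x) ∩ Z).card + (if x ∈ Z then 1 else 0) =
      (S ∩ Z).card + (if y ∈ Z then 1 else 0) := by
  have h1 : (S.erase x ∩ Z).card + (if x ∈ Z then 1 else 0) = (S ∩ Z).card := by
    rw [Finset.erase_inter]
    split_ifs with h
    · exact Finset.card_erase_add_one (by simp [hx, h])
    · rw [Finset.erase_eq_of_notMem (by simp [h]), add_zero]
  have h2 : (insert y (S.erase x) ∩ Z).card =
      (S.erase x ∩ Z).card + (if y ∈ Z then 1 else 0) := by
    split_ifs with h
    · rw [Finset.insert_inter_of_mem h, Finset.card_insert_of_notMem (by simp [hy])]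
    · rw [Finset.insert_inter_of_notMem h, add_zero]
  omega

theorem card_insert_inter {T : Finset C} {y : C} (hy : y ∉ T) (Z : Finset C) :
    (insert y T ∩ Z).card = (T ∩ Z).card + (if y ∈ Z then 1 else 0) := by
  split_ifs with h
  · rw [Finset.insert_inter_of_mem h, Finset.card_insert_of_notMem (by simp [hy])]
  · rw [Finset.insert_inter_of_notMem h, add_zero]

/-- For a laminar collection, an inequality between two counting measures passes to the union. -/
theorem card_inter_biUnion_le_of_laminar {S S' : Finset C} (A : Finset (Finset C))
    (hA : ∀ X ∈ A, ∀ Y ∈ A, Disjoint X Y ∨ X ⊆ Y ∨ Y ⊆ X)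
    (hle : ∀ X ∈ A, (S' ∩ X).card ≤ (S ∩ X).card) :
    (S' ∩ A.biUnion id).card ≤ (S ∩ A.biUnion id).card := by
  induction hn : A.card using Nat.strong_induction_on generalizing A with
  | _ n ih =>
  rcases A.eq_empty_or_nonempty with rfl | hne
  · simp
  -- A member that meets a largest member `X` lies inside it, so the union splits into `X` and the
  -- union of the members disjoint from `X`.
  obtain ⟨X, hX, hmax⟩ := A.exists_max_image Finset.card hne
  let B := (A.erase X).filter fun Y => Disjoint X Y
  have hBA : B ⊆ A := (Finset.filter_subset _ _).trans (Finset.erase_subset _ _)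
  have hXB : X ∉ B := by simp [B]
  have hU : A.biUnion id = X ∪ B.biUnion id := by
    ext c
    simp only [Finset.mem_biUnion, id, Finset.mem_union]
    constructor
    · rintro ⟨Y, hY, hc⟩
      by_cases hYX : Y = X
      · exact Or.inl (hYX ▸ hc)
      rcases hA X hX Y hY with h | h | h
      · exact Or.inr ⟨Y, by simp [B, hYX, hY, h], hc⟩
      · exact absurd (Finset.eq_of_subset_of_card_le h (hmax Y hY)).symm hYX
      · exact Or.inl (h hc)
    · rintro (h | ⟨Y, hY, hc⟩)
      · exact ⟨X, hX, h⟩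
      · exact ⟨Y, hBA hY, hc⟩
  have hd : Disjoint X (B.biUnion id) := by
    rw [Finset.disjoint_biUnion_right]
    exact fun Y hY => (Finset.mem_filter.1 hY).2
  have key : ∀ R : Finset C, (R ∩ A.biUnion id).card = (R ∩ X).card + (R ∩ B.biUnion id).card := by
    intro R
    rw [hU, Finset.inter_union_distrib_left, Finset.card_union_of_disjoint]
    exact hd.mono Finset.inter_subset_right Finset.inter_subset_right
  have hlt : B.card < n := hn ▸ Finset.card_lt_card
    (Finset.ssubset_iff_subset_ne.2 ⟨hBA, fun h => hXB (h ▸ hX)⟩)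
  have := ih B.card hlt B (fun Y hY Z hZ => hA Y (hBA hY) Z (hBA hZ))
    (fun Y hY => hle Y (hBA hY)) rfl
  rw [key, key]
  exact Nat.add_le_add (hle X hX) this

/-- The basis exchange property for laminar interval constraints that include the constraint of
having a prescribed size. -/
theorem boundedSets_exchange [Fintype C] (hF : LaminarFamily F) {r : ι}
    (hr : F r = Finset.univ) (hlr : lo r = hi r) {S S' : Finset C} (hS : S ∈ boundedSets F lo hi)
    (hS' : S' ∈ boundedSets F lo hi) {x : C} (hx : x ∈ S) (hx' : x ∉ S') :
    ∃ y ∈ S', y ∉ S ∧ insert y (S.erase x) ∈ boundedSets F lo hi := by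
  classical
  -- Classes around `x` that cannot afford to lose an element; the root is one because its two
  -- bounds agree.
  let I : Finset (Finset C) := Finset.univ.filter fun X => ∃ i, F i = X ∧ x ∈ X ∧ (S ∩ X).card = lo i
  have hI : I.Nonempty := ⟨Finset.univ, by
    have h := hS r
    rw [← hlr] at h
    simpa [I] using ⟨r, hr, by rw [hr, Finset.inter_univ] at h; omega⟩⟩
  obtain ⟨X, hXI, hmin⟩ := I.exists_min_image Finset.card hI
  obtain ⟨i, rfl, hxi, hti⟩ : ∃ i, F i = X ∧ x ∈ X ∧ (S ∩ X).card = lo i := by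
    simpa [I] using hXI
  -- Classes that would gain an element without losing `x`, and have no room for it.
  let A : Finset (Finset C) := Finset.univ.filter fun Y =>
    ∃ j, F j = Y ∧ x ∉ Y ∧ Y ⊆ F i ∧ (S ∩ Y).card = hi j
  have hA : ∀ Y ∈ A, ∃ j, F j = Y ∧ x ∉ Y ∧ Y ⊆ F i ∧ (S ∩ Y).card = hi j := by
    intro Y hY
    simpa [A] using hY
  have hU := card_inter_biUnion_le_of_laminar (S := S) (S' := S') A
    (by
      intro Y hY Z hZ
      obtain ⟨j, rfl, -⟩ := hA Y hY
      obtain ⟨l, rfl, -⟩ := hA Z hZ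
      exact hF j l)
    (by
      intro Y hY
      obtain ⟨j, rfl, -, -, h⟩ := hA Y hY
      exact h ▸ (hS' j).2)
  have hUi : A.biUnion id ⊆ F i := by
    intro c hc
    obtain ⟨Y, hY, hc⟩ := Finset.mem_biUnion.1 hc
    obtain ⟨j, -, -, h, -⟩ := hA Y hY
    exact h hc
  have hxU : x ∉ A.biUnion id := by
    intro hc
    obtain ⟨Y, hY, hc⟩ := Finset.mem_biUnion.1 hc
    obtain ⟨j, -, h, -⟩ := hA Y hY
    exact h hc
  have hsplit : ∀ R : Finset C,
      (R ∩ F i).card = (R ∩ (F i \ A.biUnion id)).card + (R ∩ A.biUnion id).card := by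
    intro R
    rw [← Finset.card_union_of_disjoint, ← Finset.inter_union_distrib_left,
      Finset.sdiff_union_of_subset hUi]
    exact Finset.sdiff_disjoint.mono Finset.inter_subset_right Finset.inter_subset_right
  have h1 := hsplit S
  have h2 := hsplit S'
  have h3 := (hS' i).1
  -- Otherwise `S'` would have strictly fewer elements than `S` in `F i` outside the union, since
  -- `x` belongs to `S` only.
  obtain ⟨y, hy, hyS⟩ : ∃ y ∈ S' ∩ (F i \ A.biUnion id), y ∉ S ∩ (F i \ A.biUnion id) := by
    by_contra! hcon
    have hsub : S' ∩ (F i \ A.biUnion id) ⊆ (S ∩ (F i \ A.biUnion id)).erase x := by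
      intro y hy
      refine Finset.mem_erase.2 ⟨?_, hcon y hy⟩
      rintro rfl
      exact hx' (Finset.mem_inter.1 hy).1
    have := Finset.card_le_card hsub
    have := Finset.card_erase_add_one
      (show x ∈ S ∩ (F i \ A.biUnion id) by
        exact Finset.mem_inter.2 ⟨hx, Finset.mem_sdiff.2 ⟨hxi, hxU⟩⟩)
    omega
  obtain ⟨hyS', hyX⟩ := Finset.mem_inter.1 hy
  obtain ⟨hyi, hyU⟩ := Finset.mem_sdiff.1 hyX
  have hyS : y ∉ S := fun h => hyS (Finset.mem_inter.2 ⟨h, hyX⟩)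
  refine ⟨y, hyS', hyS, fun j => ?_⟩
  have hc := card_insert_erase_inter hx hyS (F j)
  have hj := hS j
  by_cases hxj : x ∈ F j <;> by_cases hyj : y ∈ F j <;> simp only [hxj, hyj, if_true, if_false] at hc
  · omega
  -- A class containing `x` but not `y` cannot be at its lower bound: by minimality of `F i` it
  -- would contain `F i`, hence `y`.
  · have : (S ∩ F j).card ≠ lo j := by
      intro h
      have hm := hmin (F j) (by simpa [I] using ⟨j, rfl, hxj, h⟩)
      rcases hF.nested hxi hxj with h' | h'
      · exact hyj (h' hyi)
      · exact hyj (Finset.eq_of_subset_of_card_le h' hm ▸ hyi)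
    omega
  -- A class containing `y` but not `x` lies inside `F i`; at its upper bound it would be one of the
  -- removed classes.
  · have : (S ∩ F j).card ≠ hi j := by
      intro h
      rcases hF.nested hyi hyj with h' | h'
      · exact hxj (h' hxi)
      · exact hyU (Finset.mem_biUnion.2 ⟨F j, by simpa [A] using ⟨j, rfl, hxj, h', h⟩, hyj⟩)
    omega
  · omega

/-- A set that extends to a bounded set still does so after adding an element of a deficient
member of the family, provided that no smaller member is deficient and no upper bound is
violated. -/
theorem exists_boundedSets_insert (hF : LaminarFamily F) {T S : Finset C}
    (hS : S ∈ boundedSets F lo hi) (hTS : T ⊆ S) {i : ι} (hi_def : (T ∩ F i).card < lo i)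
    (hmin : ∀ j, (F j).card < (F i).card → lo j ≤ (T ∩ F j).card) {y : C} (hy : y ∈ F i)
    (hyT : y ∉ T) (hup : ∀ j, (insert y T ∩ F j).card ≤ hi j) :
    ∃ S' ∈ boundedSets F lo hi, insert y T ⊆ S' := by
  classical
  by_cases hyS : y ∈ S
  · exact ⟨S, hS, Finset.insert_subset hyS hTS⟩
  by_cases htight : ∃ j, y ∈ F j ∧ (S ∩ F j).card = hi j
  swap
  · push Not at htight
    refine ⟨insert y S, fun j => ?_, Finset.insert_subset_insert _ hTS⟩
    have hc := card_insert_inter hyS (F j)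
    have hj := hS j
    by_cases hyj : y ∈ F j
    · have := htight j hyj
      simp only [hyj, if_true] at hc
      omega
    · simp only [hyj, if_false] at hc
      omega
  -- A smallest full class around `y`, found by minimizing the cardinality because the index type
  -- may be infinite.
  obtain ⟨j, ⟨hyj, htj⟩, hjmin⟩ :
      ∃ j, (y ∈ F j ∧ (S ∩ F j).card = hi j) ∧
        ∀ l, (y ∈ F l ∧ (S ∩ F l).card = hi l) → (F j).card ≤ (F l).card := by
    have hex : ∃ m j, (y ∈ F j ∧ (S ∩ F j).card = hi j) ∧ (F j).card = m := by
      obtain ⟨j, h⟩ := htight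
      exact ⟨_, j, h, rfl⟩
    obtain ⟨j, h, hm⟩ := Nat.find_spec hex
    exact ⟨j, h, fun l hl => hm ▸ Nat.find_min' hex ⟨l, hl, rfl⟩⟩
  -- The smaller of the nested classes `F i` and `F j` has more elements in `S` than in `T`: `F i`
  -- because it is deficient in `T`, `F j` because it is full in `S` but still has room for `y` in
  -- `T`.
  obtain ⟨x, hxS, hxT, hxi, hxj⟩ : ∃ x ∈ S, x ∉ T ∧ x ∈ F i ∧ x ∈ F j := by
    have hlt : ∀ Z, (T ∩ Z).card < (S ∩ Z).card → ∃ x ∈ S, x ∉ T ∧ x ∈ Z := by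
      intro Z hZ
      obtain ⟨x, hx, hx'⟩ := Finset.exists_mem_notMem_of_card_lt_card hZ
      simp only [Finset.mem_inter] at hx hx'
      exact ⟨x, hx.1, fun h => hx' ⟨h, hx.2⟩, hx.2⟩
    rcases hF.nested hy hyj with h | h
    · obtain ⟨x, h1, h2, h3⟩ := hlt (F i) (hi_def.trans_le (hS i).1)
      exact ⟨x, h1, h2, h3, h h3⟩
    · have hc := card_insert_inter hyT (F j)
      have := hup j
      simp only [hyj, if_true] at hc
      obtain ⟨x, h1, h2, h3⟩ := hlt (F j) (by omega)
      exact ⟨x, h1, h2, h h3, h3⟩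
  refine ⟨insert y (S.erase x), fun l => ?_, ?_⟩
  · have hc := card_insert_erase_inter hxS hyS (F l)
    have hl := hS l
    by_cases hxl : x ∈ F l <;> by_cases hyl : y ∈ F l <;>
      simp only [hxl, hyl, if_true, if_false] at hc
    · omega
    -- A class that loses `x` without gaining `y` is strictly smaller than `F i`, so `T` already
    -- meets its lower bound and `x` is a surplus element.
    · have hli : F l ⊆ F i :=
        (hF.nested hxl hxi).resolve_right fun h => hyl (h hy)
      have h1 := hmin l (Finset.card_lt_card
        (Finset.ssubset_iff_subset_ne.2 ⟨hli, fun h => hyl (h ▸ hy)⟩))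
      have h2 : (T ∩ F l).card < (S ∩ F l).card := Finset.card_lt_card
        ⟨Finset.inter_subset_inter_right hTS, fun h =>
          hxT (Finset.mem_inter.1 (h (Finset.mem_inter.2 ⟨hxS, hxl⟩))).1⟩
      omega
    -- If full, this class would contain the smallest full class `F j`, hence `x`.
    · have : (S ∩ F l).card ≠ hi l := by
        intro h
        have hm := hjmin l ⟨hyl, h⟩
        rcases hF.nested hyj hyl with h' | h'
        · exact hxl (h' hxj)
        · exact hxl (Finset.eq_of_subset_of_card_le h' hm ▸ hxj)
      omega
    · omega
  · refine Finset.insert_subset_insert _ fun t ht => Finset.mem_erase.2 ⟨?_, hTS ht⟩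
    rintro rfl
    exact hxT ht

end Laminar

/-! ### Families of bases -/

/-- The basis exchange property of a family of finite sets. -/
def HasExchange {C : Type*} [DecidableEq C] (K : Set (Finset C)) : Prop :=
  ∀ S ∈ K, ∀ S' ∈ K, ∀ x ∈ S, x ∉ S' → ∃ y ∈ S', y ∉ S ∧ insert y (S.erase x) ∈ K

section Bases

variable {C : Type*} [Fintype C] [DecidableEq C] {K : Set (Finset C)}

/-- The matroid with a given nonempty family of bases. -/
theorem HasExchange.exists_matroid (hK : HasExchange K) (hne : K.Nonempty) :
    ∃ M : Matroid C, M.E = Set.univ ∧ (∀ B : Finset C, M.IsBase (B : Set C) ↔ B ∈ K) ∧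
      ∀ T : Finset C, M.Indep (T : Set C) ↔ T ∈ lowerExtension K := by
  obtain ⟨S₀, hS₀⟩ := hne
  let IsB : Set C → Prop := fun B => ∃ S ∈ K, (S : Set C) = B
  have hex : Matroid.ExchangeProperty IsB := by
    rintro _ _ ⟨S, hS, rfl⟩ ⟨S', hS', rfl⟩ x ⟨hx, hx'⟩
    obtain ⟨y, hy, hyS, h⟩ := hK S hS S' hS' x (by simpa using hx) (by simpa using hx')
    exact ⟨y, ⟨by simpa using hy, by simpa using hyS⟩, _, h, by simp⟩
  let M := Matroid.ofIsBaseOfFinite (E := Set.univ) Set.finite_univ IsB ⟨_, S₀, hS₀, rfl⟩ hex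
    (fun _ _ => Set.subset_univ _)
  refine ⟨M, rfl, fun B => ?_, fun T => ?_⟩
  · constructor
    · rintro ⟨S, hS, h⟩
      rwa [← Finset.coe_injective h]
    · exact fun h => ⟨B, h, rfl⟩
  · rw [Matroid.indep_iff]
    constructor
    · rintro ⟨_, ⟨S, hS, rfl⟩, h⟩
      exact ⟨S, hS, by simpa using h⟩
    · rintro ⟨S, hS, h⟩
      exact ⟨S, ⟨S, hS, rfl⟩, by simpa using h⟩

theorem lowerExtension_mono {S T : Finset C} (hT : T ∈ lowerExtension K) (h : S ⊆ T) :
    S ∈ lowerExtension K :=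
  let ⟨R, hR, hTR⟩ := hT
  ⟨R, hR, h.trans hTR⟩

/-- Bases of a matroid are equicardinal; this turns inclusions between a basis and a slightly larger
set into single exchanges. -/
theorem HasExchange.card_eq (hK : HasExchange K) {S S' : Finset C} (hS : S ∈ K) (hS' : S' ∈ K) :
    S.card = S'.card := by
  obtain ⟨M, -, hM, -⟩ := hK.exists_matroid ⟨S, hS⟩
  simpa using ((hM S).2 hS).ncard_eq_ncard_of_isBase ((hM S').2 hS')

/-- An element that can be added to a subset of a basis can be exchanged into the basis. -/
theorem HasExchange.exists_swap (hK : HasExchange K) {W S : Finset C} (hS : S ∈ K) (hWS : W ⊆ S)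
    {y : C} (hyS : y ∉ S) (hy : insert y W ∈ lowerExtension K) :
    ∃ x ∈ S, x ∉ W ∧ insert y (S.erase x) ∈ K := by
  obtain ⟨M, -, hB, hI⟩ := hK.exists_matroid ⟨S, hS⟩
  obtain ⟨B', hB', h1, h2⟩ := ((hI _).2 hy).exists_isBase_subset_union_isBase ((hB S).2 hS)
  lift B' to Finset C using Set.toFinite B'
  rw [hB] at hB'
  rw [← Finset.coe_union, Finset.coe_subset] at h2
  rw [Finset.coe_subset] at h1
  -- The new basis lies between `insert y W` and `insert y S`, and has the size of `S`, so it omits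
  -- exactly one element of `insert y S`.
  have hB'S : B' ⊆ insert y S :=
    h2.trans (Finset.union_subset (Finset.insert_subset_insert _ hWS) (Finset.subset_insert _ _))
  have hcard := hK.card_eq hB' hS
  have hyB : y ∈ B' := h1 (Finset.mem_insert_self _ _)
  have hcov : (insert y S \ B').card = 1 := by
    rw [Finset.card_sdiff_of_subset hB'S, Finset.card_insert_of_notMem hyS]
    omega
  obtain ⟨x, hx⟩ := Finset.card_eq_one.1 hcov
  have hxm : x ∈ insert y S \ B' := by simp [hx]
  obtain ⟨hx1, hx2⟩ := Finset.mem_sdiff.1 hxm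
  have hxy : x ≠ y := fun h => hx2 (h ▸ hyB)
  have hxS : x ∈ S := (Finset.mem_insert.1 hx1).resolve_left hxy
  refine ⟨x, hxS, fun h => hx2 (h1 (Finset.mem_insert_of_mem h)), ?_⟩
  have : insert y (S.erase x) = B' := by
    rw [← Finset.sdiff_sdiff_eq_self hB'S, hx, ← Finset.erase_eq,
      Finset.erase_insert_of_ne hxy.symm]
  rwa [this]

/-! ### The greedy algorithm -/

theorem separable_insert_sub (w : C → ℝ) {W : Finset C} {y : C} (hy : y ∉ W) :
    separable w (insert y W) - separable w W = w y := by
  simp [separable, Finset.sum_insert hy]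

/-- For a separable objective the marginal contribution is the weight, independent of the current
set; this is why sorting once is enough. -/
theorem isGreedyChoice_separable_iff {w : C → ℝ} {W : Finset C} {y : C} :
    IsGreedyChoice K (separable w) W y ↔ (y ∉ W ∧ insert y W ∈ lowerExtension K) ∧
      ∀ z, z ∉ W → insert z W ∈ lowerExtension K → w z ≤ w y := by
  constructor
  · rintro ⟨⟨hy, h⟩, hmax⟩
    refine ⟨⟨hy, h⟩, fun z hz hz' => ?_⟩
    have := hmax z hz hz'
    rwa [separable_insert_sub w hz, separable_insert_sub w hy] at this
  · rintro ⟨⟨hy, h⟩, hmax⟩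
    refine ⟨⟨hy, h⟩, fun z hz hz' => ?_⟩
    rw [separable_insert_sub w hz, separable_insert_sub w hy]
    exact hmax z hz hz'

theorem isGreedyRun_nil (K : Set (Finset C)) (f : Finset C → ℝ) : IsGreedyRun K f [] :=
  fun _ hi => absurd hi (by simp)

theorem isGreedyRun_concat_iff {f : Finset C → ℝ} {ys : List C} {y : C} :
    IsGreedyRun K f (ys ++ [y]) ↔ IsGreedyRun K f ys ∧ IsGreedyChoice K f ys.toFinset y := by
  constructor
  · intro h
    refine ⟨fun i hi => ?_, ?_⟩
    · have := h i (by simp; omega)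
      rwa [List.take_append_of_le_length hi.le, List.getElem_append_left hi] at this
    · simpa using h ys.length (by simp)
  · rintro ⟨h, hy⟩ i hi
    rcases Nat.lt_or_ge i ys.length with hlt | hge
    · rw [List.take_append_of_le_length hlt.le, List.getElem_append_left hlt]
      exact h i hlt
    · obtain rfl : i = ys.length := by
        simp at hi
        omega
      simpa using hy

theorem IsGreedyRun.nodup {f : Finset C → ℝ} {ys : List C} (h : IsGreedyRun K f ys) :
    ys.Nodup := by
  induction ys using List.reverseRecOn with
  | nil => exact List.nodup_nil
  | append_singleton ys y ih =>
    obtain ⟨h1, h2⟩ := isGreedyRun_concat_iff.1 h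
    rw [List.nodup_append]
    refine ⟨ih h1, List.nodup_singleton y, ?_⟩
    rintro a ha b hb rfl
    exact h2.1.1 (by simpa using (List.mem_singleton.1 hb) ▸ ha)

/-- At every stage of the greedy algorithm there is a basis of maximum value that contains the
current set. -/
theorem IsGreedyRun.exists_optimal (hK : HasExchange K) (hne : K.Nonempty) {w : C → ℝ}
    {ys : List C} (h : IsGreedyRun K (separable w) ys) :
    ∃ S ∈ K, ys.toFinset ⊆ S ∧ ∀ S' ∈ K, separable w S' ≤ separable w S := by
  induction ys using List.reverseRecOn with
  | nil =>
    obtain ⟨S, hS, hmax⟩ := (Set.toFinite K).exists_maximalFor (separable w) K hne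
    refine ⟨S, hS, by simp, fun S' hS' => ?_⟩
    rcases le_total (separable w S') (separable w S) with h' | h'
    · exact h'
    · exact hmax hS' h'
  | append_singleton ys y ih =>
    obtain ⟨h1, h2⟩ := isGreedyRun_concat_iff.1 h
    obtain ⟨S, hS, hsub, hopt⟩ := ih h1
    obtain ⟨⟨hy, hyl⟩, hmax⟩ := isGreedyChoice_separable_iff.1 h2
    have htf : (ys ++ [y]).toFinset = insert y ys.toFinset := by
      ext
      simp
    rw [htf]
    by_cases hyS : y ∈ S
    · exact ⟨S, hS, Finset.insert_subset hyS hsub, hopt⟩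
    obtain ⟨x, hxS, hxW, hswap⟩ := hK.exists_swap hS hsub hyS hyl
    refine ⟨_, hswap, Finset.insert_subset_insert _ fun t ht => Finset.mem_erase.2 ⟨?_, hsub ht⟩,
      fun S' hS' => (hopt S' hS').trans ?_⟩
    · rintro rfl
      exact hxW ht
    -- The exchanged element `x` was itself available to the greedy algorithm, so it weighs no more
    -- than `y` and the exchange loses nothing.
    · have hx := hmax x hxW ⟨S, hS, Finset.insert_subset hxS hsub⟩
      have h3 := separable_insert_sub w (Finset.notMem_erase x S)
      have h4 := separable_insert_sub w (show y ∉ S.erase x by simp [hyS])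
      rw [Finset.insert_erase hxS] at h3
      linarith

theorem IsGreedyRun.mem_lowerExtension {f : Finset C → ℝ} (hne : K.Nonempty) {ys : List C}
    (h : IsGreedyRun K f ys) : ys.toFinset ∈ lowerExtension K := by
  induction ys using List.reverseRecOn with
  | nil => exact ⟨_, hne.choose_spec, by simp⟩
  | append_singleton ys y ih =>
    have h2 := (isGreedyRun_concat_iff.1 h).2.1.2
    convert h2 using 1
    ext
    simp

/-- The greedy algorithm is not stuck at a set that is not a basis. -/
theorem exists_isGreedyChoice {w : C → ℝ} {W S : Finset C} (hS : S ∈ K) (hWS : W ⊂ S) :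
    ∃ y, IsGreedyChoice K (separable w) W y := by
  classical
  obtain ⟨x, hxS, hxW⟩ := Finset.exists_of_ssubset hWS
  obtain ⟨y, hy, hmax⟩ :=
    (Finset.univ.filter fun z => z ∉ W ∧ insert z W ∈ lowerExtension K).exists_max_image w
      ⟨x, by simpa using ⟨hxW, S, hS, Finset.insert_subset hxS hWS.1⟩⟩
  refine ⟨y, isGreedyChoice_separable_iff.2 ⟨by simpa using hy, fun z hz hz' => hmax z ?_⟩⟩
  simpa using ⟨hz, hz'⟩

/-- Going through the elements by decreasing weight, the greedy algorithm accepts every element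
that can be added; rejected elements need not be considered again. -/
theorem IsGreedyRun.concat {w : C → ℝ} {ys done rest : List C} {y : C}
    (h : IsGreedyRun K (separable w) ys) (hall : ∀ c, c ∈ done ++ y :: rest)
    (hsort : (done ++ y :: rest).Pairwise fun a b => w b ≤ w a)
    (hdone : ∀ c ∈ done, c ∈ ys ∨ insert c ys.toFinset ∉ lowerExtension K)
    (hy : y ∉ ys) (hyl : insert y ys.toFinset ∈ lowerExtension K) :
    IsGreedyRun K (separable w) (ys ++ [y]) := by
  refine isGreedyRun_concat_iff.2 ⟨h, isGreedyChoice_separable_iff.2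
    ⟨⟨by simpa using hy, hyl⟩, fun z hz hz' => ?_⟩⟩
  have hz1 := hall z
  rw [List.mem_append, List.mem_cons] at hz1
  rcases hz1 with hd | rfl | hr
  · exact ((hdone z hd).elim (fun h => hz (by simpa using h)) fun h => h hz').elim
  · exact le_rfl
  · exact List.rel_of_pairwise_cons (List.pairwise_append.1 hsort).2.1 hr

end Bases

/-! ### Diverse committees -/

section Committees

variable {C L : Type*} [Fintype C] [DecidableEq C] [DecidableEq L] {lab : C → Finset L}

/-- The candidate sets of the labels, together with the set of all candidates. -/
def rootedClasses (lab : C → Finset L) : Option L → Finset C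
  | none => Finset.univ
  | some l => labelClass lab l

theorem IsOneLaminar.laminarFamily_rootedClasses (h : IsOneLaminar lab) :
    LaminarFamily (rootedClasses lab) := by
  rintro (_ | x) (_ | y)
  · exact Or.inr (Or.inl subset_rfl)
  · exact Or.inr (Or.inr (Finset.subset_univ _))
  · exact Or.inr (Or.inl (Finset.subset_univ _))
  · by_cases hxy : x = y
    · exact hxy ▸ Or.inr (Or.inl subset_rfl)
    · simpa [rootedClasses, Finset.disjoint_iff_inter_eq_empty] using h x y hxy

/-- The size requirement becomes the constraint of the root, with `k` as both bounds. -/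
theorem diverseCommittees_eq_boundedSets (lab : C → Finset L) (b₁ b₂ : L → ℕ) (k : ℕ) :
    diverseCommittees (intervalSpec lab b₁ b₂) k =
      boundedSets (rootedClasses lab) (fun o => o.elim k b₁) (fun o => o.elim k b₂) := by
  ext S
  simp only [diverseCommittees, intervalSpec, boundedSets, Set.mem_ofPred_eq, Option.forall,
    rootedClasses, Option.elim, Finset.inter_univ]
  constructor
  · rintro ⟨h, h'⟩
    exact ⟨⟨h'.ge, h'.le⟩, h⟩
  · rintro ⟨⟨h1, h2⟩, h⟩
    exact ⟨h, h2.antisymm h1⟩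

theorem IsOneLaminar.hasExchange (h : IsOneLaminar lab) (b₁ b₂ : L → ℕ) (k : ℕ) :
    HasExchange (diverseCommittees (intervalSpec lab b₁ b₂) k) := by
  rw [diverseCommittees_eq_boundedSets]
  intro S hS S' hS' x hx hx'
  exact boundedSets_exchange (lo := fun o => o.elim k b₁) (hi := fun o => o.elim k b₂)
    h.laminarFamily_rootedClasses (r := none) rfl rfl hS hS' hx hx'

/-- An optimal committee contains the chosen set, and both have `k` elements. -/
theorem IsGreedyRun.isWinningCommittee {D : Finset C → Prop} {k : ℕ} {w : C → ℝ}
    (hK : HasExchange (diverseCommittees D k)) (hne : (diverseCommittees D k).Nonempty)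
    {ys : List C} (h : IsGreedyRun (diverseCommittees D k) (separable w) ys)
    (hlen : ys.length = k) : IsWinningCommittee D k (separable w) ys.toFinset := by
  obtain ⟨S, hS, hsub, hopt⟩ := h.exists_optimal hK hne
  have hc := List.toFinset_card_of_nodup h.nodup
  have : ys.toFinset = S := Finset.eq_of_subset_of_card_le hsub (by rw [hc, hlen, hS.2])
  exact this ▸ ⟨hS, hopt⟩

theorem IsGreedyRun.exists_choice {D : Finset C → Prop} {k : ℕ} {w : C → ℝ}
    (hne : (diverseCommittees D k).Nonempty)
    {ys : List C} (h : IsGreedyRun (diverseCommittees D k) (separable w) ys)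
    (hlen : ys.length < k) :
    ∃ y, IsGreedyChoice (diverseCommittees D k) (separable w) ys.toFinset y := by
  obtain ⟨S, hS, hsub⟩ := h.mem_lowerExtension hne
  have hc := List.toFinset_card_of_nodup h.nodup
  refine exists_isGreedyChoice hS (Finset.ssubset_iff_subset_ne.2 ⟨hsub, fun he => ?_⟩)
  have := hS.2
  rw [← he, hc] at this
  omega

end Committees

end DCWD

namespace DCWD

/-! ### Reasoning about programs -/

/-- The memory after writing to a register. -/
def Mem.setReg (s : Mem) (r v : ℕ) : Mem := ⟨Function.update s.reg r v, s.arr⟩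

/-- The memory after writing to an array. -/
def Mem.setArr (s : Mem) (a i v : ℕ) : Mem :=
  ⟨s.reg, Function.update s.arr a (Function.update (s.arr a) i v)⟩

section Mem

variable (s : Mem)

@[simp] theorem Mem.setReg_arr (r v : ℕ) : (s.setReg r v).arr = s.arr := rfl

@[simp] theorem Mem.setReg_reg_self (r v : ℕ) : (s.setReg r v).reg r = v := by
  simp [Mem.setReg]

@[simp] theorem Mem.setReg_reg_of_ne {r r' : ℕ} (v : ℕ) (h : r' ≠ r) :
    (s.setReg r v).reg r' = s.reg r' := by
  simp [Mem.setReg, h]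

@[simp] theorem Mem.setArr_reg (a i v : ℕ) : (s.setArr a i v).reg = s.reg := rfl

theorem Mem.setArr_arr (a i v a' i' : ℕ) :
    (s.setArr a i v).arr a' i' = if a' = a ∧ i' = i then v else s.arr a' i' := by
  by_cases h : a' = a
  · subst h
    simp [Mem.setArr, Function.update_apply]
  · simp [Mem.setArr, h]

@[simp] theorem Mem.setArr_arr_self (a i v : ℕ) :
    (s.setArr a i v).arr a = Function.update (s.arr a) i v := by
  simp [Mem.setArr]

@[simp] theorem Mem.setArr_arr_of_ne {a a' : ℕ} (i v : ℕ) (h : a' ≠ a) :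
    (s.setArr a i v).arr a' = s.arr a' := by
  simp [Mem.setArr, h]

end Mem

/-- The registers a program may write to. -/
def Prog.regs : Prog → List ℕ
  | .skip => []
  | .assign r _ => [r]
  | .store _ _ _ => []
  | .seq p q => p.regs ++ q.regs
  | .ite _ p q => p.regs ++ q.regs
  | .loop _ p => p.regs

/-- The arrays a program may write to. -/
def Prog.arrs : Prog → List ℕ
  | .skip => []
  | .assign _ _ => []
  | .store a _ _ => [a]
  | .seq p q => p.arrs ++ q.arrs
  | .ite _ p q => p.arrs ++ q.arrs
  | .loop _ p => p.arrs

/-- The two memories agree on everything that the program cannot write to. -/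
structure Frame (P : Prog) (s s' : Mem) : Prop where
  reg : ∀ r, r ∉ P.regs → s'.reg r = s.reg r
  arr : ∀ a, a ∉ P.arrs → s'.arr a = s.arr a

theorem Frame.refl (P : Prog) (s : Mem) : Frame P s s := ⟨fun _ _ => rfl, fun _ _ => rfl⟩

theorem Frame.trans {P Q R : Prog} {s s' s'' : Mem} (h : Frame P s s') (h' : Frame Q s' s'')
    (hPr : P.regs ⊆ R.regs) (hPa : P.arrs ⊆ R.arrs) (hQr : Q.regs ⊆ R.regs)
    (hQa : Q.arrs ⊆ R.arrs) : Frame R s s'' :=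
  ⟨fun r hr => (h'.reg r fun h => hr (hQr h)).trans (h.reg r fun h => hr (hPr h)),
    fun a ha => (h'.arr a fun h => ha (hQa h)).trans (h.arr a fun h => ha (hPa h))⟩

theorem Frame.mono {P R : Prog} {s s' : Mem} (h : Frame P s s')
    (hPr : P.regs ⊆ R.regs) (hPa : P.arrs ⊆ R.arrs) : Frame R s s' :=
  ⟨fun r hr => h.reg r fun h => hr (hPr h), fun a ha => h.arr a fun h => ha (hPa h)⟩

/-- Allows specifications to mention only what changes. Everything else is recovered by deciding
non-membership in the syntactic lists of written registers and arrays. -/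
theorem Exec.frame {wt : ℕ → ℝ} {P : Prog} {s s' : Mem} {t : ℕ} (h : Exec wt P s s' t) :
    Frame P s s' := by
  induction h with
  | skip s => exact Frame.refl _ _
  | assign r e s =>
    refine ⟨fun r' hr => ?_, fun _ _ => rfl⟩
    simp only [Prog.regs, List.mem_singleton] at hr
    simp [hr]
  | store a i e s =>
    refine ⟨fun _ _ => rfl, fun a' ha => ?_⟩
    simp only [Prog.arrs, List.mem_singleton] at ha
    simp [ha]
  | seq _ _ ih1 ih2 =>
    exact ih1.trans ih2 (by simp [Prog.regs]) (by simp [Prog.arrs])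
      (by simp [Prog.regs]) (by simp [Prog.arrs])
  | iteTrue _ _ ih => exact ih.mono (by simp [Prog.regs]) (by simp [Prog.arrs])
  | iteFalse _ _ ih => exact ih.mono (by simp [Prog.regs]) (by simp [Prog.arrs])
  | loopTrue _ _ _ ih1 ih2 =>
    exact ih1.trans ih2 (by simp [Prog.regs]) (by simp [Prog.arrs])
      (by simp [Prog.regs]) (by simp [Prog.arrs])
  | loopFalse _ => exact Frame.refl _ _

/-- Started in memory `s`, the program halts after at most `T` steps in a memory that
satisfies `Q`. -/
def Runs (wt : ℕ → ℝ) (P : Prog) (s : Mem) (T : ℕ) (Q : Mem → Prop) : Prop :=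
  ∃ s' t, Exec wt P s s' t ∧ t ≤ T ∧ Q s'

section Runs

variable {wt : ℕ → ℝ} {P p q : Prog} {s : Mem} {T : ℕ} {Q R : Mem → Prop}

theorem Runs.conseq (h : Runs wt P s T R) {T' : ℕ} (hT : T ≤ T')
    (hQ : ∀ s', Frame P s s' → R s' → Q s') : Runs wt P s T' Q :=
  let ⟨s', t, he, ht, hR⟩ := h
  ⟨s', t, he, ht.trans hT, hQ s' he.frame hR⟩

theorem Runs.skip (hT : 1 ≤ T) (h : Q s) : Runs wt .skip s T Q :=
  ⟨s, 1, Exec.skip s, hT, h⟩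

theorem Runs.assign {r : ℕ} {e : Expr} (hT : e.cost + 1 ≤ T) (h : Q (s.setReg r (e.eval s))) :
    Runs wt (.assign r e) s T Q :=
  ⟨_, _, Exec.assign r e s, hT, h⟩

theorem Runs.store {a : ℕ} {i e : Expr} (hT : i.cost + e.cost + 1 ≤ T)
    (h : Q (s.setArr a (i.eval s) (e.eval s))) : Runs wt (.store a i e) s T Q :=
  ⟨_, _, Exec.store a i e s, hT, h⟩

theorem Runs.seq {T₁ T₂ : ℕ} (h : Runs wt p s T₁ R)
    (h' : ∀ s', Frame p s s' → R s' → Runs wt q s' T₂ Q) (hT : T₁ + T₂ ≤ T) :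
    Runs wt (.seq p q) s T Q := by
  obtain ⟨s', t, he, ht, hR⟩ := h
  obtain ⟨s'', t', he', ht', hQ⟩ := h' s' he.frame hR
  exact ⟨s'', t + t', he.seq he', by omega, hQ⟩

theorem Runs.assign_seq {r : ℕ} {e : Expr} {T' : ℕ}
    (h : Runs wt q (s.setReg r (e.eval s)) T' Q) (hT : e.cost + 1 + T' ≤ T) :
    Runs wt (.seq (.assign r e) q) s T Q :=
  Runs.seq (R := fun s' => s' = s.setReg r (e.eval s)) (Runs.assign le_rfl rfl)
    (fun _ _ hs => hs ▸ h) hT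

theorem Runs.store_seq {a : ℕ} {i e : Expr} {T' : ℕ}
    (h : Runs wt q (s.setArr a (i.eval s) (e.eval s)) T' Q) (hT : i.cost + e.cost + 1 + T' ≤ T) :
    Runs wt (.seq (.store a i e) q) s T Q :=
  Runs.seq (R := fun s' => s' = s.setArr a (i.eval s) (e.eval s)) (Runs.store le_rfl rfl)
    (fun _ _ hs => hs ▸ h) hT

theorem Runs.ite {b : Test} {T' : ℕ} (hp : b.holds wt s → Runs wt p s T' Q)
    (hq : ¬ b.holds wt s → Runs wt q s T' Q) (hT : b.cost + 1 + T' ≤ T) :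
    Runs wt (.ite b p q) s T Q := by
  by_cases hb : b.holds wt s
  · obtain ⟨s', t, he, ht, hQ⟩ := hp hb
    exact ⟨s', _, Exec.iteTrue hb he, by omega, hQ⟩
  · obtain ⟨s', t, he, ht, hQ⟩ := hq hb
    exact ⟨s', _, Exec.iteFalse hb he, by omega, hQ⟩

/-- The rule for loops: the invariant has the remaining time as a parameter. -/
theorem Runs.loop {b : Test} (Inv : ℕ → Mem → Prop) (h : Inv T s)
    (step : ∀ T s', Inv T s' → Frame P s s' → b.holds wt s' →
      ∃ T₁ T₂, Runs wt P s' T₁ (Inv T₂) ∧ b.cost + 1 + T₁ + T₂ ≤ T) :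
    Runs wt (.loop b P) s (T + b.cost + 1) fun s' => (∃ T, Inv T s') ∧ ¬ b.holds wt s' := by
  suffices H : ∀ T s', Inv T s' → Frame P s s' →
      Runs wt (.loop b P) s' (T + b.cost + 1) fun s' => (∃ T, Inv T s') ∧ ¬ b.holds wt s' from
    H T s h (Frame.refl _ _)
  intro T
  -- Every evaluation of the test costs at least one step, so the remaining time decreases strictly;
  -- termination and the time bound come from the same induction.
  induction T using Nat.strong_induction_on with
  | _ T ih =>
  intro s' hI hF
  by_cases hb : b.holds wt s'
  · obtain ⟨T₁, T₂, ⟨s₁, t₁, he₁, ht₁, hI₁⟩, hT⟩ := step T s' hI hF hb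
    obtain ⟨s₂, t₂, he₂, ht₂, hQ⟩ := ih T₂ (by omega) s₁ hI₁
      (hF.trans he₁.frame (List.Subset.refl _) (List.Subset.refl _) (List.Subset.refl _)
        (List.Subset.refl _))
    exact ⟨s₂, _, Exec.loopTrue hb he₁ he₂, by omega, hQ⟩
  · exact ⟨s', _, Exec.loopFalse hb, by omega, ⟨T, hI⟩, hb⟩

/-- Run the programs of a list one after the other. -/
def Prog.seqs : List Prog → Prog
  | [] => .skip
  | [p] => p
  | p :: q :: ps => .seq p (Prog.seqs (q :: ps))

/-- Repeat `P` with register `r` counting from its present value up to register `e`, exclusively. -/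
def Prog.forLoop (r e : ℕ) (P : Prog) : Prog :=
  .loop (.lt (.reg r) (.reg e)) (.seq P (.assign r (.add (.reg r) (.lit 1))))

theorem Runs.forLoop {r e : ℕ} (Inv : ℕ → Mem → Prop) (N B : ℕ) (h0 : Inv (s.reg r) s)
    (hle : s.reg r ≤ N) (hN : s.reg e = N) (hr : r ∉ P.regs) (he : e ∉ P.regs) (hre : e ≠ r)
    (step : ∀ i s', s.reg r ≤ i → i < N → s'.reg r = i → Frame (Prog.forLoop r e P) s s' →
      Inv i s' → Runs wt P s' B fun s'' => Inv (i + 1) (s''.setReg r (i + 1))) :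
    Runs wt (Prog.forLoop r e P) s ((N - s.reg r) * (B + 8) + 4)
      fun s' => Inv N s' ∧ s'.reg r = N := by
  -- The `8` is the overhead of a round, four steps for the test and four for the increment.
  refine (Runs.loop (T := (N - s.reg r) * (B + 8)) (fun T s' => ∃ i, s'.reg r = i ∧ s.reg r ≤ i ∧
    i ≤ N ∧ Inv i s' ∧ (N - i) * (B + 8) ≤ T) ⟨_, rfl, le_rfl, hle, h0, le_rfl⟩ ?_).conseq ?_ ?_
  · rintro T s' ⟨i, hi, hsi, hiN, hI, hT⟩ hF hb
    have hF' : Frame (Prog.forLoop r e P) s s' := hF.mono (List.Subset.refl _) (List.Subset.refl _)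
    have hlt : i < N := by
      have he' := hF.reg e (by simp [Prog.regs, he, hre])
      simp only [Test.holds, Expr.eval, hi, he', hN] at hb
      exact hb
    refine ⟨B + 4, (N - (i + 1)) * (B + 8), ?_, ?_⟩
    · refine Runs.seq (step i s' hsi hlt hi hF' hI) (T₂ := 4) ?_ le_rfl
      intro s'' hF'' hI''
      refine Runs.assign (by simp [Expr.cost]) ?_
      have hrr : s''.reg r = i := (hF''.reg r hr).trans hi
      refine ⟨i + 1, ?_, by omega, by omega, ?_, le_rfl⟩
      · simp [Expr.eval, hrr]
      · simpa [Expr.eval, hrr] using hI''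
    · obtain ⟨d, hd⟩ : ∃ d, N - i = d + 1 := ⟨N - i - 1, by omega⟩
      have hd' : N - (i + 1) = d := by omega
      rw [hd, add_mul] at hT
      rw [hd']
      simp only [Test.cost, Expr.cost]
      omega
  · simp [Test.cost, Expr.cost]
  · rintro s' hF ⟨⟨T, i, hi, -, hiN, hI, -⟩, hb⟩
    have he' := hF.reg e (by simp [Prog.regs, he, hre])
    simp only [Test.holds, Expr.eval, hi, he', hN] at hb
    obtain rfl : i = N := by omega
    exact ⟨hI, hi⟩

/-- Run `P` with register `r` counting from `0` up to register `e`, exclusively. -/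
def Prog.forRange (r e : ℕ) (P : Prog) : Prog :=
  .seq (.assign r (.lit 0)) (Prog.forLoop r e P)

theorem Runs.forRange {r e : ℕ} (Inv : ℕ → Mem → Prop) (N B : ℕ) (h0 : Inv 0 (s.setReg r 0))
    (hN : s.reg e = N) (hr : r ∉ P.regs) (he : e ∉ P.regs) (hre : e ≠ r)
    (step : ∀ i s', i < N → s'.reg r = i → Frame (Prog.forRange r e P) s s' →
      Inv i s' → Runs wt P s' B fun s'' => Inv (i + 1) (s''.setReg r (i + 1))) :
    Runs wt (Prog.forRange r e P) s (N * (B + 8) + 6) fun s' => Inv N s' := by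
  refine Runs.assign_seq (T' := N * (B + 8) + 4) ?_ (by simp only [Expr.cost]; omega)
  simp only [Expr.eval]
  refine (Runs.forLoop Inv N B (by simpa using h0) (by simp) (by simp [hre, hN]) hr he hre
    ?_).conseq (by simp) (fun _ _ h => h.1)
  intro i s' _ hi hs hF hI
  refine step i s' hi hs ⟨fun r' hr' => ?_, fun a ha => ?_⟩ hI
  · simp only [Prog.forRange, Prog.forLoop, Prog.regs, List.mem_append, List.mem_singleton,
      not_or] at hr'
    rw [hF.reg r' (by simp [Prog.forLoop, Prog.regs, hr']), Mem.setReg_reg_of_ne _ _ hr'.1]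
  · simp only [Prog.forRange, Prog.forLoop, Prog.arrs, List.nil_append, List.append_nil] at ha
    rw [hF.arr a (by simp [Prog.forLoop, Prog.arrs, ha]), Mem.setReg_arr]

/-- Copy the beginning of an array to another array. -/
def Prog.copy (dst src r e : ℕ) : Prog :=
  .forRange r e (.store dst (.reg r) (.get src (.reg r)))

theorem Runs.copy {dst src r e N : ℕ} (hN : s.reg e = N) (hre : e ≠ r) (hds : src ≠ dst) :
    Runs wt (Prog.copy dst src r e) s (N * 12 + 6)
      fun s' => ∀ i < N, s'.arr dst i = s.arr src i := by
  refine (Runs.forRange (fun i s' => ∀ j < i, s'.arr dst j = s.arr src j) N 4 (by simp) hN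
    (by simp [Prog.regs]) (by simp [Prog.regs]) hre ?_).conseq le_rfl fun _ _ h => h
  intro i s' hi hs hF hI
  refine Runs.store (by simp [Expr.cost]) ?_
  have hsrc : s'.arr src = s.arr src :=
    hF.arr src (by simp [Prog.forRange, Prog.forLoop, Prog.arrs, hds])
  intro j hj
  simp only [Expr.eval, Mem.setReg_arr, Mem.setArr_arr, hs, hsrc, true_and]
  split_ifs with h
  · rw [h]
  · exact hI j (by omega)

/-- Set the register `f` to `1` if the test holds for all values of register `r` below
register `e`, and to `0` otherwise. -/
def Prog.scanAll (f r e : ℕ) (b : Test) : Prog :=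
  .seq (.assign f (.lit 1)) (.forRange r e (.ite b .skip (.assign f (.lit 0))))

theorem Runs.scanAll {f r e N : ℕ} {b : Test} (φ : ℕ → Prop) (hN : s.reg e = N) (hre : e ≠ r)
    (hef : e ≠ f) (hrf : r ≠ f)
    (hb : ∀ l s', l < N → s'.reg r = l → Frame (Prog.scanAll f r e b) s s' →
      (b.holds wt s' ↔ φ l)) :
    Runs wt (Prog.scanAll f r e b) s (N * (b.cost + 11) + 8)
      fun s' => (s'.reg f = 1 ∧ ∀ l < N, φ l) ∨ (s'.reg f = 0 ∧ ∃ l < N, ¬ φ l) := by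
  refine Runs.assign_seq (T' := N * (b.cost + 11) + 6) ?_ (by simp only [Expr.cost]; omega)
  simp only [Expr.eval]
  refine (Runs.forRange (fun i s' => (s'.reg f = 1 ∧ ∀ l < i, φ l) ∨
    (s'.reg f = 0 ∧ ∃ l < i, ¬ φ l)) N (b.cost + 3)
    (by simp [hrf.symm]) (by simp [hef, hN]) (by simp [Prog.regs, hrf]) (by simp [Prog.regs, hef])
    hre ?_).conseq (by simp [add_assoc]) fun _ _ h => h
  intro i s' hi hs hF hI
  have hb' := hb i s' hi hs ⟨fun r' hr' => by
      simp only [Prog.scanAll, Prog.forRange, Prog.forLoop, Prog.regs, List.mem_append,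
        List.mem_singleton, not_or] at hr'
      rw [hF.reg r' (by simp [Prog.forRange, Prog.forLoop, Prog.regs, hr']),
        Mem.setReg_reg_of_ne _ _ hr'.1],
    fun a _ => by
      rw [hF.arr a (by simp [Prog.forRange, Prog.forLoop, Prog.arrs]), Mem.setReg_arr]⟩
  refine Runs.ite (T' := 2) (fun hh => Runs.skip (by simp) ?_)
    (fun hh => Runs.assign (by simp [Expr.cost]) ?_) (by omega)
  · rw [hb'] at hh
    simp only [Mem.setReg_reg_of_ne _ _ hrf.symm]
    refine hI.imp (fun h => ⟨h.1, fun l hl => ?_⟩) fun ⟨h, l, hl, h'⟩ => ⟨h, l, by omega, h'⟩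
    rcases Nat.lt_succ_iff_lt_or_eq.1 hl with h1 | rfl
    · exact h.2 l h1
    · exact hh
  · rw [hb'] at hh
    simp only [Mem.setReg_reg_of_ne _ _ hrf.symm, Mem.setReg_reg_self, Expr.eval]
    exact Or.inr ⟨trivial, i, by omega, hh⟩

end Runs

end DCWD

namespace DCWD

/-! ### Segments of arrays -/

/-- The list of the entries with indices from `lo` up to `hi`, exclusively. -/
def segment (f : ℕ → ℕ) (lo hi : ℕ) : List ℕ := (List.range' lo (hi - lo)).map f

section Segment

variable {f g : ℕ → ℕ} {lo mid hi : ℕ}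

theorem segment_of_le (h : hi ≤ lo) : segment f lo hi = [] := by
  simp [segment, Nat.sub_eq_zero_of_le h]

@[simp] theorem segment_self (f : ℕ → ℕ) (lo : ℕ) : segment f lo lo = [] := segment_of_le le_rfl

theorem segment_cons (h : lo < hi) : segment f lo hi = f lo :: segment f (lo + 1) hi := by
  obtain ⟨d, rfl⟩ := Nat.exists_eq_add_of_lt h
  have h1 : lo + d + 1 - lo = d + 1 := by omega
  have h2 : lo + d + 1 - (lo + 1) = d := by omega
  simp [segment, h1, h2, List.range'_succ]

theorem segment_append (h : lo ≤ mid) (h' : mid ≤ hi) :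
    segment f lo mid ++ segment f mid hi = segment f lo hi := by
  obtain ⟨d, rfl⟩ := Nat.exists_eq_add_of_le h
  obtain ⟨d', rfl⟩ := Nat.exists_eq_add_of_le h'
  have h1 : lo + d + d' - lo = d + d' := by omega
  simp [segment, h1, ← List.map_append]

theorem segment_concat (h : lo ≤ hi) : segment f lo (hi + 1) = segment f lo hi ++ [f hi] := by
  rw [← segment_append h (Nat.le_succ hi), segment_cons (Nat.lt_succ_self hi), segment_self]

theorem segment_congr (h : ∀ i, lo ≤ i → i < hi → f i = g i) :
    segment f lo hi = segment g lo hi := by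
  refine List.map_congr_left fun i hi' => ?_
  rw [List.mem_range'_1] at hi'
  exact h i hi'.1 (by omega)

@[simp] theorem length_segment (f : ℕ → ℕ) (lo hi : ℕ) : (segment f lo hi).length = hi - lo := by
  simp [segment]

theorem segment_zero (f : ℕ → ℕ) (m : ℕ) : segment f 0 m = (List.range m).map f := by
  simp [segment, List.range_eq_range']

theorem segment_update_of_le (f : ℕ → ℕ) {lo hi i : ℕ} (v : ℕ) (h : hi ≤ i) :
    segment (Function.update f i v) lo hi = segment f lo hi :=
  segment_congr fun j _ hj => by rw [Function.update_of_ne (by omega)]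

theorem pairwise_segment_iff {R : ℕ → ℕ → Prop} :
    (segment f lo hi).Pairwise R ↔ ∀ i j, lo ≤ i → i < j → j < hi → R (f i) (f j) := by
  rw [segment, List.pairwise_map, List.pairwise_iff_getElem]
  simp only [List.length_range', List.getElem_range', one_mul]
  constructor
  · intro h i j hi' hij hj
    have := h (i - lo) (j - lo) (by omega) (by omega) (by omega)
    rwa [Nat.add_sub_cancel' hi', Nat.add_sub_cancel' (by omega)] at this
  · intro h i j hi' hj hij
    exact h _ _ (by omega) (by omega) (by omega)

end Segment

/-! ### Merge sort -/

/-- Copy the larger one of the first remaining elements of two runs. -/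
def mergeStep : Prog :=
  .ite (.and (.lt (.reg 24) (.reg 22)) (.not (.and (.lt (.reg 25) (.reg 23))
      (.not (.wle (.get 4 (.reg 25)) (.get 4 (.reg 24)))))))
    (.seq (.store 5 (.reg 26) (.get 4 (.reg 24))) (.assign 24 (.add (.reg 24) (.lit 1))))
    (.seq (.store 5 (.reg 26) (.get 4 (.reg 25))) (.assign 25 (.add (.reg 25) (.lit 1))))

/-- Merge two adjacent runs of array `4` into array `5`. -/
def mergeRuns : Prog :=
  Prog.seqs [.assign 24 (.reg 21), .assign 25 (.reg 22), .assign 26 (.reg 21),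
    .forLoop 26 23 mergeStep]

/-- The comparison of candidates by weight. -/
noncomputable def heavier (wt : ℕ → ℝ) (a b : ℕ) : Bool := decide (wt b ≤ wt a)

variable {wt : ℕ → ℝ} {s : Mem}

theorem runs_mergeRuns {lo mid hi : ℕ} (h21 : s.reg 21 = lo) (h22 : s.reg 22 = mid)
    (h23 : s.reg 23 = hi) (hlm : lo ≤ mid) (hmh : mid ≤ hi) :
    Runs wt mergeRuns s ((hi - lo) * 32 + 10) fun s' =>
      segment (s'.arr 5) lo hi = List.merge (segment (s.arr 4) lo mid) (segment (s.arr 4) mid hi)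
        (heavier wt) ∧ ∀ x < lo, s'.arr 5 x = s.arr 5 x := by
  refine Runs.assign_seq (Runs.assign_seq (Runs.assign_seq
    (T' := (hi - lo) * 32 + 4) ?_ le_rfl) le_rfl) (by simp only [Expr.cost]; omega)
  simp only [Expr.eval, h21, h22, Mem.setReg_reg_of_ne _ _ (show 22 ≠ 24 by decide),
    Mem.setReg_reg_of_ne _ _ (show 21 ≠ 24 by decide),
    Mem.setReg_reg_of_ne _ _ (show 21 ≠ 25 by decide)]
  -- Invariant: what has been written, followed by the merge of the two remainders, is the full
  -- merge. Entries before `lo` are untouched, so earlier blocks survive.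
  refine (Runs.forLoop (fun p s' => ∃ i j, s'.reg 24 = i ∧ s'.reg 25 = j ∧ lo ≤ i ∧ i ≤ mid ∧
    mid ≤ j ∧ j ≤ hi ∧ i + j = p + mid ∧
    segment (s'.arr 5) lo p ++ List.merge (segment (s.arr 4) i mid) (segment (s.arr 4) j hi)
      (heavier wt) = List.merge (segment (s.arr 4) lo mid) (segment (s.arr 4) mid hi)
        (heavier wt) ∧ ∀ x < lo, s'.arr 5 x = s.arr 5 x) hi 24 ?_ ?_ ?_ (by decide) (by decide)
        (by decide) ?_).conseq ?_ ?_
  · exact ⟨lo, mid, by simp, by simp, le_rfl, hlm, le_rfl, hmh,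
      by simp, by simp, by simp⟩
  · simpa using hlm.trans hmh
  · simp [h23]
  · rintro p s' hp hph hps hF ⟨i, j, hi', hj', hloi, him, hmj, hjh, hij, hseg, hfix⟩
    simp only [Mem.setReg_reg_self] at hp
    have e4 : s'.arr 4 = s.arr 4 := by rw [hF.arr 4 (by decide)]; rfl
    have e22 : s'.reg 22 = mid := by
      rw [hF.reg 22 (by decide)]; simp [h22]
    have e23 : s'.reg 23 = hi := by
      rw [hF.reg 23 (by decide)]; simp [h23]
    refine Runs.ite (T' := 8) ?_ ?_ (by simp [Test.cost, Expr.cost])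
    · intro hb
      simp only [Test.holds, Expr.eval, hi', hj', e22, e23, e4, not_and, not_not] at hb
      obtain ⟨him', hb⟩ := hb
      refine Runs.store_seq (T' := 4) (Runs.assign (by simp [Expr.cost]) ?_) (by simp [Expr.cost])
      simp only [Expr.eval, hi', hps, e4]
      refine ⟨i + 1, j, by simp [hi'], by simp [hj'], by omega,
        by omega, hmj, hjh, by omega, ?_, ?_⟩
      · rw [← hseg, Mem.setReg_arr, Mem.setReg_arr, Mem.setArr_arr_self, segment_concat hp,
          segment_update_of_le _ _ le_rfl, Function.update_self, List.append_assoc]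
        congr 1
        rw [segment_cons him']
        rcases Nat.lt_or_ge j hi with hjl | hjl
        · rw [segment_cons hjl, List.cons_merge_cons_pos]
          · rfl
          · simpa [heavier] using hb hjl
        · simp [segment_of_le hjl]
      · intro x hx
        rw [← hfix x hx]
        simp only [Mem.setReg_arr, Mem.setArr_arr]
        rw [if_neg (by omega)]
    · intro hb
      simp only [Test.holds, Expr.eval, hi', hj', e22, e23, e4, not_and, not_not] at hb
      refine Runs.store_seq (T' := 4) (Runs.assign (by simp [Expr.cost]) ?_) (by simp [Expr.cost])
      have hjl : j < hi := by
        by_contra hjl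
        exact hb (by omega) fun h => absurd h hjl
      simp only [Expr.eval, hj', hps, e4]
      refine ⟨i, j + 1, by simp [hi'], by simp [hj'], by omega,
        by omega, by omega, by omega, by omega, ?_, ?_⟩
      · rw [← hseg, Mem.setReg_arr, Mem.setReg_arr, Mem.setArr_arr_self, segment_concat hp,
          segment_update_of_le _ _ le_rfl, Function.update_self, List.append_assoc]
        congr 1
        rw [segment_cons hjl]
        rcases Nat.lt_or_ge i mid with him' | him'
        · rw [segment_cons him', List.cons_merge_cons_neg]
          · rfl
          · have := hb him'
            push Not at this
            simpa [heavier] using this.2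
        · simp [segment_of_le him']
      · intro x hx
        rw [← hfix x hx]
        simp only [Mem.setReg_arr, Mem.setArr_arr]
        rw [if_neg (by omega)]
  · simp only [Mem.setReg_reg_self]
    omega
  · rintro s' - ⟨⟨i, j, -, -, -, him, -, hjh, hij, hseg, hfix⟩, -⟩
    obtain rfl : i = mid := by omega
    obtain rfl : j = hi := by omega
    exact ⟨by simpa using hseg, hfix⟩

/-- Every block of length `w` is sorted by weight. -/
def BlocksSorted (wt : ℕ → ℝ) (w n : ℕ) (f : ℕ → ℕ) : Prop :=
  ∀ q i j, q * w ≤ i → i < j → j < q * w + w → j < n → wt (f j) ≤ wt (f i)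

theorem pairwise_merge_heavier {l l' : List ℕ} (h : l.Pairwise fun a b => wt b ≤ wt a)
    (h' : l'.Pairwise fun a b => wt b ≤ wt a) :
    (List.merge l l' (heavier wt)).Pairwise fun a b => wt b ≤ wt a := by
  have := List.pairwise_merge (le := heavier wt)
    (by simp only [heavier, decide_eq_true_eq]; exact fun a b c h h' => h'.trans h)
    (by simp only [heavier, Bool.or_eq_true, decide_eq_true_eq]; exact fun a b => le_total _ _)
    l l' (by simpa [heavier] using h) (by simpa [heavier] using h')
  simpa [heavier] using this

/-- The expression `min (x + y) z`. -/
def Expr.minAdd (x y z : Expr) : Expr := .sub (.add x y) (.sub (.add x y) z)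

theorem Expr.minAdd_eval (x y z : Expr) (s : Mem) :
    (Expr.minAdd x y z).eval s = min (x.eval s + y.eval s) (z.eval s) := by
  simp only [Expr.minAdd, Expr.eval]
  omega

/-- Merge adjacent blocks of length `w`, where `w` is in register `20`. -/
def mergePass : Prog :=
  Prog.seqs [.assign 21 (.lit 0),
    .loop (.lt (.reg 21) (.reg 0)) (Prog.seqs [
      .assign 22 (Expr.minAdd (.reg 21) (.reg 20) (.reg 0)),
      .assign 23 (Expr.minAdd (.reg 22) (.reg 20) (.reg 0)),
      mergeRuns,
      .assign 21 (.reg 23)])]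

theorem runs_mergePass {n w : ℕ} (hn : s.reg 0 = n) (hw : s.reg 20 = w) (hw1 : 1 ≤ w)
    (hsort : BlocksSorted wt w n (s.arr 4)) :
    Runs wt mergePass s (n * 68 + 6) fun s' => BlocksSorted wt (w + w) n (s'.arr 5) ∧
      (segment (s'.arr 5) 0 n).Perm (segment (s.arr 4) 0 n) := by
  refine Runs.assign_seq (T' := n * 68 + 4) ?_ (by simp only [Expr.cost]; omega)
  -- Merging two blocks costs 32 per element plus 36 in overhead; as the pair of blocks is nonempty,
  -- 68 per element suffices.
  refine (Runs.loop (T := n * 68) (fun T s' => ∃ lo, s'.reg 21 = lo ∧ lo ≤ n ∧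
    ((∃ q, lo = q * (w + w)) ∨ lo = n) ∧ BlocksSorted wt (w + w) lo (s'.arr 5) ∧
    (segment (s'.arr 5) 0 lo).Perm (segment (s.arr 4) 0 lo) ∧ (n - lo) * 68 ≤ T) ?_ ?_).conseq
    (by simp [Test.cost, Expr.cost]) ?_
  · exact ⟨0, by simp [Expr.eval], by simp, Or.inl ⟨0, by simp⟩, by simp [BlocksSorted], by simp,
      by simp⟩
  · rintro T s₁ ⟨lo, h21, hlon, hq, hbs, hperm, hT⟩ hF hb
    have e0 : s₁.reg 0 = n := by rw [hF.reg 0 (by decide)]; simp [hn]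
    have e20 : s₁.reg 20 = w := by rw [hF.reg 20 (by decide)]; simp [hw]
    have e4 : s₁.arr 4 = s.arr 4 := by rw [hF.arr 4 (by decide)]; rfl
    simp only [Test.holds, Expr.eval, h21, e0] at hb
    obtain ⟨q, hq⟩ := hq.resolve_right hb.ne
    obtain ⟨mid, hmid⟩ : ∃ mid, mid = min (lo + w) n := ⟨_, rfl⟩
    obtain ⟨hi, hhi⟩ : ∃ hi, hi = min (mid + w) n := ⟨_, rfl⟩
    refine ⟨(hi - lo) * 32 + 32, (n - hi) * 68, ?_, ?_⟩
    · refine Runs.assign_seq (Runs.assign_seq (T' := (hi - lo) * 32 + 12) ?_ le_rfl)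
        (by simp only [Expr.cost, Expr.minAdd]; omega)
      simp only [Expr.minAdd_eval, Expr.eval, h21, e20, e0, Mem.setReg_reg_self,
        Mem.setReg_reg_of_ne _ _ (show 20 ≠ 22 by decide),
        Mem.setReg_reg_of_ne _ _ (show 0 ≠ 22 by decide), ← hmid, ← hhi]
      refine Runs.seq (runs_mergeRuns (lo := lo) (mid := mid) (hi := hi)
        (by simp [h21]) (by simp) (by simp) (by omega)
        (by omega)) (T₂ := 2) ?_ le_rfl
      rintro s₂ hF₂ ⟨hseg, hfix⟩
      simp only [Mem.setReg_arr, e4] at hseg hfix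
      refine Runs.assign (by simp [Expr.cost]) ?_
      have e23 : s₂.reg 23 = hi := by rw [hF₂.reg 23 (by decide)]; simp
      refine ⟨hi, by simp [Expr.eval, e23], by omega, ?_, ?_, ?_, le_rfl⟩
      · rcases Nat.lt_or_ge hi n with h | h
        · exact Or.inl ⟨q + 1, by rw [add_mul]; omega⟩
        · exact Or.inr (by omega)
      · have hpw : (segment (s₂.arr 5) lo hi).Pairwise fun a b => wt b ≤ wt a := by
          rw [hseg]
          refine pairwise_merge_heavier (pairwise_segment_iff.2 ?_) (pairwise_segment_iff.2 ?_)
          -- The `q`-th block of double length consists of the old blocks `2 * q` and `2 * q + 1`,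
          -- possibly cut off at `n`.
          · exact fun i j h1 h2 h3 => hsort (2 * q) i j
              (by rw [show 2 * q * w = q * (w + w) by ring]; omega) h2
              (by rw [show 2 * q * w = q * (w + w) by ring]; omega) (by omega)
          · exact fun i j h1 h2 h3 => hsort (2 * q + 1) i j
              (by rw [show (2 * q + 1) * w = q * (w + w) + w by ring]; omega) h2
              (by rw [show (2 * q + 1) * w = q * (w + w) + w by ring]; omega) (by omega)
        rw [pairwise_segment_iff] at hpw
        intro q' i j h1 h2 h3 h4
        simp only [Mem.setReg_arr]
        rcases Nat.lt_trichotomy q' q with h | rfl | h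
        · have := Nat.mul_le_mul_right (w + w) (Nat.succ_le_of_lt h)
          rw [Nat.succ_mul] at this
          rw [hfix i (by omega), hfix j (by omega)]
          exact hbs q' i j h1 h2 h3 (by omega)
        · exact hpw i j (by omega) h2 h4
        · have := Nat.mul_le_mul_right (w + w) (Nat.succ_le_of_lt h)
          rw [Nat.succ_mul] at this
          omega
      · simp only [Mem.setReg_arr]
        rw [← segment_append (Nat.zero_le lo) (show lo ≤ hi by omega),
          ← segment_append (Nat.zero_le lo) (show lo ≤ hi by omega),
          segment_congr fun i _ h => hfix i h, hseg]
        refine hperm.append ((List.merge_perm_append (le := heavier wt)).trans ?_)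
        rw [segment_append (by omega) (by omega)]
    · simp only [Test.cost, Expr.cost]
      omega
  · rintro s' hF ⟨⟨T, lo, h21, hlon, -, hbs, hperm, -⟩, hb⟩
    have e0 : s'.reg 0 = n := by rw [hF.reg 0 (by decide)]; simp [hn]
    simp only [Test.holds, Expr.eval, h21, e0] at hb
    obtain rfl : lo = n := by omega
    exact ⟨hbs, hperm⟩

/-- Sort the numbers below register `0` into array `4` by decreasing weight. -/
def mergeSort : Prog :=
  Prog.seqs [.forRange 27 0 (.store 4 (.reg 27) (.reg 27)), .assign 20 (.lit 1),
    .loop (.lt (.reg 20) (.reg 0)) (Prog.seqs [mergePass, Prog.copy 4 5 27 0,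
      .assign 20 (.add (.reg 20) (.reg 20))])]

theorem runs_mergeSort {n : ℕ} (hn : s.reg 0 = n) :
    Runs wt mergeSort s ((n * 80 + 20) * Nat.clog 2 n + n * 11 + 12) fun s' =>
      (segment (s'.arr 4) 0 n).Pairwise (fun a b => wt b ≤ wt a) ∧
        (segment (s'.arr 4) 0 n).Perm (List.range n) := by
  refine Runs.seq (T₁ := n * 11 + 6) (T₂ := (n * 80 + 20) * Nat.clog 2 n + 6)
    (Runs.forRange (fun i s' => ∀ j < i, s'.arr 4 j = j) n 3 (by simp) hn (by decide) (by decide)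
      (by decide) ?_) ?_ (by omega)
  · intro i s' _ hi _ hI
    refine Runs.store (by simp [Expr.cost]) fun j hj => ?_
    simp only [Expr.eval, hi, Mem.setReg_arr, Mem.setArr_arr, true_and]
    split_ifs with h
    · exact h.symm
    · exact hI j (by omega)
  intro s₁ hF₁ hI₁
  refine Runs.assign_seq (T' := (n * 80 + 20) * Nat.clog 2 n + 4) ?_
    (by simp only [Expr.cost]; omega)
  have e0 : s₁.reg 0 = n := by rw [hF₁.reg 0 (by decide), hn]
  -- The number `r` bounds the remaining doublings of the block length `w`; initially `w = 1` and
  -- `r` is the rounded-up binary logarithm.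
  refine (Runs.loop (T := (n * 80 + 20) * Nat.clog 2 n) (fun T s' => ∃ w r, s'.reg 20 = w ∧
    1 ≤ w ∧ n ≤ w * 2 ^ r ∧ BlocksSorted wt w n (s'.arr 4) ∧
    (segment (s'.arr 4) 0 n).Perm (List.range n) ∧ (n * 80 + 20) * r ≤ T) ?_ ?_).conseq
    (by simp [Test.cost, Expr.cost]) ?_
  · refine ⟨1, Nat.clog 2 n, by simp [Expr.eval], le_rfl, ?_, fun q i j _ _ _ => by omega, ?_,
      le_rfl⟩
    · simpa using Nat.le_pow_clog (by norm_num) n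
    · rw [Mem.setReg_arr, segment_congr (g := id) fun i _ hi => hI₁ i hi, segment_zero]
      simp
  · rintro T s₂ ⟨w, r, h20, hw, hwr, hbs, hperm, hT⟩ hF hb
    have e0' : s₂.reg 0 = n := by rw [hF.reg 0 (by decide)]; simp [e0]
    simp only [Test.holds, Expr.eval, h20, e0'] at hb
    obtain ⟨r, rfl⟩ : ∃ r', r = r' + 1 := by
      rcases r with _ | r
      · simp at hwr
        omega
      · exact ⟨r, rfl⟩
    refine ⟨n * 80 + 16, (n * 80 + 20) * r, ?_, ?_⟩
    · refine Runs.seq (runs_mergePass e0' h20 hw hbs) (T₂ := n * 12 + 10) ?_ (by omega)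
      rintro s₃ hF₃ ⟨hbs₃, hperm₃⟩
      refine Runs.seq (Runs.copy (N := n) (by rw [hF₃.reg 0 (by decide), e0']) (by decide)
        (by decide)) (T₂ := 4) ?_ le_rfl
      intro s₄ hF₄ hcopy
      refine Runs.assign (by simp [Expr.cost]) ?_
      have e20 : s₄.reg 20 = w := by
        rw [hF₄.reg 20 (by decide), hF₃.reg 20 (by decide), h20]
      refine ⟨w + w, r, by simp [Expr.eval, e20], by omega, ?_, ?_, ?_, le_rfl⟩
      · rw [pow_succ] at hwr
        linarith
      · intro q i j h1 h2 h3 h4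
        rw [Mem.setReg_arr, hcopy i (by omega), hcopy j h4]
        exact hbs₃ q i j h1 h2 h3 h4
      · rw [Mem.setReg_arr, segment_congr fun i _ hi => hcopy i hi]
        exact hperm₃.trans hperm
    · simp only [Test.cost, Expr.cost]
      rw [mul_add] at hT
      omega
  · rintro s' hF ⟨⟨T, w, r, h20, hw, hwr, hbs, hperm, -⟩, hb⟩
    have e0' : s'.reg 0 = n := by rw [hF.reg 0 (by decide)]; simp [e0]
    simp only [Test.holds, Expr.eval, h20, e0'] at hb
    exact ⟨pairwise_segment_iff.2 fun i j h1 h2 h3 => hbs 0 i j (by omega) h2 (by omega) h3, hperm⟩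

end DCWD

namespace DCWD

/-! ### Instances as laminar families indexed by natural numbers -/

namespace Instance

variable (I : Instance)

/-- The candidate set of the label with number `l`; the number after the last label stands for
the set of all candidates. -/
def classes (l : ℕ) : Finset (Fin I.numCands) :=
  if h : l < I.numLabels then labelClass I.lab ⟨l, h⟩
  -- Beyond the root the classes are empty and the bounds are `0`. Those constraints are void, and
  -- the bounds agree with the zeros that the memory holds past the input.
  else if l = I.numLabels then Finset.univ else ∅

/-- The lower bounds for `Instance.classes`. -/
def lowerBound (l : ℕ) : ℕ :=
  if h : l < I.numLabels then I.lower ⟨l, h⟩ else if l = I.numLabels then I.size else 0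

/-- The upper bounds for `Instance.classes`. -/
def upperBound (l : ℕ) : ℕ :=
  if h : l < I.numLabels then I.upper ⟨l, h⟩ else if l = I.numLabels then I.size else 0

/-- The diverse committees of the desired size. -/
abbrev committees : Set (Finset (Fin I.numCands)) := diverseCommittees I.spec I.size

variable {I}

theorem classes_numLabels : I.classes I.numLabels = Finset.univ := by simp [classes]

theorem lowerBound_numLabels : I.lowerBound I.numLabels = I.size := by simp [lowerBound]

theorem classes_of_gt {l : ℕ} (h : I.numLabels < l) : I.classes l = ∅ := by
  simp [classes, h.ne', not_lt.2 h.le]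

theorem lowerBound_of_gt {l : ℕ} (h : I.numLabels < l) : I.lowerBound l = 0 := by
  simp [lowerBound, h.ne', not_lt.2 h.le]

theorem mem_classes {l : ℕ} (hl : l < I.numLabels) {c : Fin I.numCands} :
    c ∈ I.classes l ↔ l ∈ (I.labelList c).map Fin.val := by
  simp only [classes, hl, dif_pos, labelClass, lab, Finset.mem_filter, Finset.mem_univ, true_and,
    List.mem_toFinset, List.mem_map]
  constructor
  · exact fun h => ⟨_, h, rfl⟩
  · rintro ⟨x, h, rfl⟩
    exact h

theorem committees_eq_boundedSets :
    I.committees = boundedSets I.classes I.lowerBound I.upperBound := by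
  ext S
  simp only [diverseCommittees, spec, intervalSpec, boundedSets, Set.mem_ofPred_eq]
  constructor
  · rintro ⟨h, h'⟩ l
    rcases Nat.lt_trichotomy l I.numLabels with hl | rfl | hl
    · simpa [classes, lowerBound, upperBound, hl] using h ⟨l, hl⟩
    · simp [classes, lowerBound, upperBound, h']
    · simp [classes, lowerBound, hl.ne', not_lt.2 hl.le]
  · intro h
    refine ⟨fun l => ?_, ?_⟩
    · simpa [classes, lowerBound, upperBound, l.2] using h l
    · have := h I.numLabels
      simp only [classes, lowerBound, upperBound, lt_self_iff_false, dif_neg, not_false_eq_true,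
        if_true, Finset.inter_univ] at this
      omega

theorem laminarFamily_classes (h : IsOneLaminar I.lab) : LaminarFamily I.classes := by
  intro x y
  rcases Nat.lt_trichotomy x I.numLabels with hx | rfl | hx
  · rcases Nat.lt_trichotomy y I.numLabels with hy | rfl | hy
    · simpa [rootedClasses, classes, hx, hy] using
        h.laminarFamily_rootedClasses (some ⟨x, hx⟩) (some ⟨y, hy⟩)
    · exact Or.inr (Or.inl (classes_numLabels ▸ Finset.subset_univ _))
    · simp [classes_of_gt hy]
  · exact Or.inr (Or.inr (classes_numLabels ▸ Finset.subset_univ _))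
  · simp [classes_of_gt hx]

/-- The number of entries of a list of candidates that have label `l`. -/
def countIn (zs : List (Fin I.numCands)) (l : ℕ) : ℕ := zs.countP fun c => c ∈ I.classes l

theorem countIn_eq_card {zs : List (Fin I.numCands)} (h : zs.Nodup) (l : ℕ) :
    countIn zs l = (zs.toFinset ∩ I.classes l).card := by
  rw [countIn, List.countP_eq_length_filter, ← List.toFinset_card_of_nodup (h.filter _)]
  congr 1
  ext c
  simp

theorem countIn_numLabels (zs : List (Fin I.numCands)) :
    countIn zs I.numLabels = zs.length := by
  rw [countIn, List.countP_eq_length]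
  simp [classes_numLabels]

/-- Serves to cut the labels of one candidate, the middle piece, out of the concatenation of all
label lists. -/
theorem segment_getD_append (A B D : List ℕ) :
    segment (fun i => (A ++ (B ++ D)).getD i 0) A.length (A.length + B.length) = B := by
  refine List.ext_getElem (by simp) fun i h1 h2 => ?_
  simp only [segment, List.getElem_map, List.getElem_range', one_mul]
  rw [List.getD_append_right _ _ _ _ (by omega), List.getD_append _ _ _ _ (by omega),
    List.getD_eq_getElem _ _ (by omega)]
  congr 1
  omega

theorem initMem_offset {c : ℕ} (hc : c ≤ I.numCands) :
    I.initMem.arr 0 c = ((List.ofFn I.labelList).take c).flatten.length := by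
  simp only [initMem, inputArray]
  rw [List.getD_eq_getElem _ _ (by simp; omega)]
  simp

theorem ofFn_labelList_eq (c : Fin I.numCands) : List.ofFn I.labelList =
    (List.ofFn I.labelList).take c ++ (I.labelList c :: (List.ofFn I.labelList).drop (c + 1)) := by
  conv_lhs => rw [← List.take_append_drop c (List.ofFn I.labelList)]
  rw [List.drop_eq_getElem_cons (by simp)]
  simp

theorem initMem_offset_succ (c : Fin I.numCands) :
    I.initMem.arr 0 (c + 1) = I.initMem.arr 0 c + (I.labelList c).length := by
  rw [initMem_offset c.2, initMem_offset c.2.le, List.take_succ_eq_append_getElem (by simp)]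
  simp

theorem segment_labels (c : Fin I.numCands) :
    segment (I.initMem.arr 1) (I.initMem.arr 0 c) (I.initMem.arr 0 (c + 1)) =
      (I.labelList c).map Fin.val := by
  have h := segment_getD_append (((List.ofFn I.labelList).take c).flatten.map Fin.val)
    ((I.labelList c).map Fin.val) (((List.ofFn I.labelList).drop (c + 1)).flatten.map Fin.val)
  rw [← List.map_append, ← List.map_append, ← List.flatten_cons, ← List.flatten_append,
    ← ofFn_labelList_eq, List.length_map, List.length_map, ← initMem_offset c.2.le,
    ← initMem_offset_succ] at h
  exact h

theorem count_labels (c : Fin I.numCands) {l : ℕ} (hl : l < I.numLabels) :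
    ((I.labelList c).map Fin.val).count l = if c ∈ I.classes l then 1 else 0 := by
  rw [List.Nodup.count ((I.nodup c).map Fin.val_injective)]
  simp only [mem_classes hl]

theorem length_labelList_le (c : Fin I.numCands) : (I.labelList c).length ≤ I.numLabels := by
  simpa using (I.nodup c).length_le_card

end Instance

/-! ### Counting the members of label classes -/

/-- The memory contains the input, with the desired size as the bounds of an additional label. -/
structure Ready (I : Instance) (s : Mem) : Prop where
  reg0 : s.reg 0 = I.numCands
  reg1 : s.reg 1 = I.numLabels
  reg2 : s.reg 2 = I.size
  reg10 : s.reg 10 = I.numLabels + 1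
  arr0 : s.arr 0 = I.initMem.arr 0
  arr1 : s.arr 1 = I.initMem.arr 1
  arr2 : s.arr 2 = I.lowerBound
  arr3 : s.arr 3 = I.upperBound

variable {I : Instance} {wt : ℕ → ℝ} {s : Mem}

theorem Ready.of_frame {P : Prog} {s' : Mem} (h : Ready I s) (hF : Frame P s s')
    (hr : ∀ r ∈ [0, 1, 2, 10], r ∉ P.regs) (ha : ∀ a ∈ [0, 1, 2, 3], a ∉ P.arrs) : Ready I s' where
  reg0 := (hF.reg 0 (hr 0 (by decide))).trans h.reg0
  reg1 := (hF.reg 1 (hr 1 (by decide))).trans h.reg1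
  reg2 := (hF.reg 2 (hr 2 (by decide))).trans h.reg2
  reg10 := (hF.reg 10 (hr 10 (by decide))).trans h.reg10
  arr0 := (hF.arr 0 (ha 0 (by decide))).trans h.arr0
  arr1 := (hF.arr 1 (ha 1 (by decide))).trans h.arr1
  arr2 := (hF.arr 2 (ha 2 (by decide))).trans h.arr2
  arr3 := (hF.arr 3 (ha 3 (by decide))).trans h.arr3

theorem Ready.setReg (h : Ready I s) {r v : ℕ} (hr : r ∉ [0, 1, 2, 10]) :
    Ready I (s.setReg r v) := by
  simp only [List.mem_cons, List.not_mem_nil, or_false, not_or] at hr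
  obtain ⟨h0, h1, h2, h10⟩ := hr
  exact ⟨by simp [Ne.symm h0, h.reg0], by simp [Ne.symm h1, h.reg1], by simp [Ne.symm h2, h.reg2],
    by simp [Ne.symm h10, h.reg10], h.arr0, h.arr1, h.arr2, h.arr3⟩

theorem Ready.setArr (h : Ready I s) {a i v : ℕ} (ha : a ∉ [0, 1, 2, 3]) :
    Ready I (s.setArr a i v) := by
  simp only [List.mem_cons, List.not_mem_nil, or_false, not_or] at ha
  obtain ⟨h0, h1, h2, h3⟩ := ha
  exact ⟨h.reg0, h.reg1, h.reg2, h.reg10, by simp [Ne.symm h0, h.arr0],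
    by simp [Ne.symm h1, h.arr1], by simp [Ne.symm h2, h.arr2], by simp [Ne.symm h3, h.arr3]⟩

/-- Count the labels of the candidate with index `reg 6` in the list in array `6`. -/
def countLabels : Prog :=
  Prog.seqs [.assign 8 (.get 0 (.add (.get 6 (.reg 6)) (.lit 1))),
    .assign 7 (.get 0 (.get 6 (.reg 6))),
    .forLoop 7 8 (.store 7 (.get 1 (.reg 7)) (.add (.get 7 (.get 1 (.reg 7))) (.lit 1)))]

theorem runs_countLabels (hs : Ready I s) {c : Fin I.numCands} (hc : s.arr 6 (s.reg 6) = c) :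
    Runs wt countLabels s (I.numLabels * 16 + 14) fun s' =>
      ∀ l < I.numLabels, s'.arr 7 l = s.arr 7 l + if c ∈ I.classes l then 1 else 0 := by
  refine Runs.assign_seq (Runs.assign_seq (T' := I.numLabels * 16 + 4) ?_ le_rfl)
    (by simp only [Expr.cost]; omega)
  simp only [Expr.eval, hc, Mem.setReg_arr, hs.arr0,
    Mem.setReg_reg_of_ne _ _ (show 6 ≠ 8 by decide)]
  obtain ⟨a, ha⟩ : ∃ a, a = I.initMem.arr 0 c := ⟨_, rfl⟩
  have hlen := Instance.length_labelList_le c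
  have hb := Instance.initMem_offset_succ c
  -- The counts have grown by the multiplicities in the part of the label list read so far; since
  -- the list has no repetitions, the final multiplicities are `0` or `1`.
  refine (Runs.forLoop (fun p s' => ∀ l, s'.arr 7 l = s.arr 7 l +
    (segment (I.initMem.arr 1) a p).count l) (I.initMem.arr 0 (c + 1)) 8 (by simp [ha])
    (by simp [hb]) (by simp) (by decide) (by decide) (by decide) ?_).conseq ?_ ?_
  · intro p s' hp hpb hps hF hI
    have e1 : s'.arr 1 = I.initMem.arr 1 := by rw [hF.arr 1 (by decide)]; exact hs.arr1
    refine Runs.store (by simp [Expr.cost]) fun l => ?_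
    simp only [Mem.setReg_reg_self] at hp
    simp only [Expr.eval, hps, e1, Mem.setReg_arr, Mem.setArr_arr, true_and,
      segment_concat (ha ▸ hp), List.count_append, List.count_singleton, beq_iff_eq, hI]
    split_ifs with h1 h2 h2
    · rw [h1]; ring
    · exact absurd h1.symm h2
    · exact absurd h2.symm h1
    · ring
  · simp only [Mem.setReg_reg_self, hb]
    omega
  · rintro s' - ⟨hI, -⟩ l hl
    rw [hI, ha, Instance.segment_labels, Instance.count_labels c hl]

/-- For the first `reg 3` candidates in array `6`, count in array `7` the candidates that have a
label, and in register `5` the occurrences of the candidate `reg 4`. -/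
def countProg : Prog :=
  Prog.seqs [.forRange 9 1 (.store 7 (.reg 9) (.lit 0)), .assign 5 (.lit 0),
    .forRange 6 3 (.seq countLabels (.ite (.eq (.get 6 (.reg 6)) (.reg 4))
      (.assign 5 (.add (.reg 5) (.lit 1))) .skip)),
    -- Every candidate belongs to the root, so the count of the root is the length of the list.
    .store 7 (.reg 1) (.reg 3)]

/-- Repetitions in the list are allowed, because a tentative insertion may repeat a candidate; the
occurrence count in register `5` is there to detect this. -/
theorem runs_countProg (hs : Ready I s) {zs : List (Fin I.numCands)} {m : ℕ} (hm : s.reg 3 = m)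
    (hzs : segment (s.arr 6) 0 m = zs.map Fin.val) :
    Runs wt countProg s (50 * ((m + 1) * (I.numLabels + 1))) fun s' =>
      (∀ l ≤ I.numLabels, s'.arr 7 l = Instance.countIn zs l) ∧
        s'.reg 5 = (zs.map Fin.val).count (s.reg 4) := by
  have hlen : zs.length = m := by simpa using (congrArg List.length hzs).symm
  refine Runs.seq (T₁ := I.numLabels * 11 + 6) (T₂ := m * (I.numLabels * 16 + 31) + 11)
    (Runs.forRange (fun i s' => ∀ l < i, s'.arr 7 l = 0) I.numLabels 3 (by simp) hs.reg1
      (by decide) (by decide) (by decide) ?_) ?_ (by ring_nf; omega)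
  · intro i s' _ hi _ hI
    refine Runs.store (by simp [Expr.cost]) fun j hj => ?_
    simp only [Expr.eval, hi, Mem.setReg_arr, Mem.setArr_arr, true_and]
    split_ifs with h
    · rfl
    · exact hI j (by omega)
  intro s₁ hF₁ hI₁
  have hs₁ : Ready I s₁ := hs.of_frame hF₁ (by decide) (by decide)
  refine Runs.assign_seq (T' := m * (I.numLabels * 16 + 31) + 9) ?_ (by simp only [Expr.cost]; omega)
  simp only [Expr.eval]
  refine Runs.seq (T₁ := m * (I.numLabels * 16 + 31) + 6) (T₂ := 3)
    (Runs.forRange (fun j s' => (∀ l < I.numLabels, s'.arr 7 l = Instance.countIn (zs.take j) l) ∧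
      s'.reg 5 = ((zs.take j).map Fin.val).count (s.reg 4)) m (I.numLabels * 16 + 23) ?_ ?_
      (by decide) (by decide) (by decide) ?_) ?_ le_rfl
  · simpa [Instance.countIn] using hI₁
  · simp [hF₁.reg 3 (by decide), hm]
  · rintro j s₂ hj hj6 hF₂ ⟨hc, ho⟩
    have hs₂ : Ready I s₂ := (hs₁.setReg (by decide)).of_frame hF₂ (by decide) (by decide)
    have e6 : s₂.arr 6 = s.arr 6 := by
      rw [hF₂.arr 6 (by decide), Mem.setReg_arr, hF₁.arr 6 (by decide)]
    have hz : s.arr 6 j = (zs[j]'(by omega) : Fin I.numCands) := by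
      have := List.getElem_of_eq hzs (i := j) (by simpa using hj)
      simpa [segment] using this
    have htake : zs.take (j + 1) = zs.take j ++ [zs[j]'(by omega)] :=
      List.take_succ_eq_append_getElem (by omega)
    refine Runs.seq (runs_countLabels hs₂ (c := zs[j]'(by omega)) (by rw [hj6, e6, hz]))
      (T₂ := 9) ?_ (by omega)
    intro s₃ hF₃ hI₃
    have e5 : s₃.reg 5 = s₂.reg 5 := hF₃.reg 5 (by decide)
    have e4 : s₃.reg 4 = s.reg 4 := by
      rw [hF₃.reg 4 (by decide), hF₂.reg 4 (by decide), Mem.setReg_reg_of_ne _ _ (by decide),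
        hF₁.reg 4 (by decide)]
    have e6' : s₃.arr 6 (s₃.reg 6) = (zs[j]'(by omega) : Fin I.numCands) := by
      rw [hF₃.arr 6 (by decide), hF₃.reg 6 (by decide), hj6, e6, hz]
    have hcnt : ∀ l < I.numLabels, s₃.arr 7 l = Instance.countIn (zs.take (j + 1)) l := by
      intro l hl
      rw [hI₃ l hl, hc l hl, htake, Instance.countIn, Instance.countIn, List.countP_append,
        List.countP_singleton]
      simp
    refine Runs.ite (T' := 4) (fun hb => Runs.assign (by simp [Expr.cost]) ⟨?_, ?_⟩)
      (fun hb => Runs.skip (by simp) ⟨?_, ?_⟩) (by simp [Test.cost, Expr.cost])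
    · simpa using hcnt
    · simp only [Test.holds, Expr.eval, e6', e4] at hb
      rw [htake, List.map_append, List.count_append, ← ho, ← e5]
      simp [Expr.eval, hb]
    · simpa using hcnt
    · simp only [Test.holds, Expr.eval, e6', e4] at hb
      rw [htake, List.map_append, List.count_append, ← ho, ← e5]
      simp [hb]
  · rintro s₂ hF₂ ⟨hc, ho⟩
    have hs₂ : Ready I s₂ := (hs₁.setReg (by decide)).of_frame hF₂ (by decide) (by decide)
    have e3 : s₂.reg 3 = m := by
      rw [hF₂.reg 3 (by decide), Mem.setReg_reg_of_ne _ _ (by decide), hF₁.reg 3 (by decide), hm]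
    rw [← hlen, List.take_length] at hc ho
    refine Runs.store (by simp [Expr.cost]) ⟨fun l hl => ?_, ho⟩
    simp only [Expr.eval, hs₂.reg1, e3, Mem.setArr_arr, true_and]
    split_ifs with h
    · rw [h, Instance.countIn_numLabels, hlen]
    · exact hc l (by omega)

/-- Test in register `11` whether the counts respect the upper bounds. -/
def checkUpper : Prog := .scanAll 11 9 10 (.not (.lt (.get 3 (.reg 9)) (.get 7 (.reg 9))))

/-- Test in register `12` whether the counts respect the lower bounds. -/
def checkLower : Prog := .scanAll 12 9 10 (.not (.lt (.get 7 (.reg 9)) (.get 2 (.reg 9))))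

theorem runs_checkUpper (hs : Ready I s) {f : ℕ → ℕ} (hf : ∀ l ≤ I.numLabels, s.arr 7 l = f l) :
    Runs wt checkUpper s ((I.numLabels + 1) * 17 + 8) fun s' =>
      s'.reg 11 = 1 ↔ ∀ l ≤ I.numLabels, f l ≤ I.upperBound l := by
  refine (Runs.scanAll (fun l => f l ≤ I.upperBound l) hs.reg10 (by decide) (by decide) (by decide)
    fun l s' hl hsl hF => ?_).conseq (by simp [Test.cost, Expr.cost]) fun s' _ h => ?_
  · simp only [Test.holds, Expr.eval, hsl, hF.arr 3 (by decide), hF.arr 7 (by decide), hs.arr3,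
      hf l (by omega), not_lt]
  · simp only [Nat.lt_succ_iff] at h
    rcases h with ⟨h, h'⟩ | ⟨h, l, hl, h'⟩
    · exact ⟨fun _ => h', fun _ => h⟩
    · exact ⟨fun h1 => by omega, fun h1 => absurd (h1 l hl) h'⟩

theorem runs_checkLower (hs : Ready I s) {f : ℕ → ℕ} (hf : ∀ l ≤ I.numLabels, s.arr 7 l = f l) :
    Runs wt checkLower s ((I.numLabels + 1) * 17 + 8) fun s' => (s'.reg 12 = 0 ∨ s'.reg 12 = 1) ∧
      (s'.reg 12 = 1 ↔ ∀ l ≤ I.numLabels, I.lowerBound l ≤ f l) := by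
  refine (Runs.scanAll (fun l => I.lowerBound l ≤ f l) hs.reg10 (by decide) (by decide)
    (by decide) fun l s' hl hsl hF => ?_).conseq (by simp [Test.cost, Expr.cost]) fun s' _ h => ?_
  · simp only [Test.holds, Expr.eval, hsl, hF.arr 2 (by decide), hF.arr 7 (by decide), hs.arr2,
      hf l (by omega), not_lt]
  · simp only [Nat.lt_succ_iff] at h
    rcases h with ⟨h, h'⟩ | ⟨h, l, hl, h'⟩
    · exact ⟨Or.inr h, fun _ => h', fun _ => h⟩
    · exact ⟨Or.inl h, fun h1 => by omega, fun h1 => absurd (h1 l hl) h'⟩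

end DCWD

namespace DCWD

/-! ### Building a first diverse committee by serving smallest deficient labels -/

namespace Instance

variable {I : Instance}

/-- The list can be the beginning of the construction of a diverse committee. -/
structure IsPartial (I : Instance) (ts : List (Fin I.numCands)) : Prop where
  nodup : ts.Nodup
  upper : ∀ l ≤ I.numLabels, countIn ts l ≤ I.upperBound l
  -- Conditional, because the program does not know yet whether any committee exists.
  extends_of_nonempty : I.committees.Nonempty → ∃ S ∈ I.committees, ts.toFinset ⊆ S

/-- Label `x` is a smallest label with too few members in the list. -/
structure IsDeficient (I : Instance) (ts : List (Fin I.numCands)) (x : ℕ) : Prop where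
  le_numLabels : x ≤ I.numLabels
  lt_lowerBound : countIn ts x < I.lowerBound x
  minimal : ∀ l, (I.classes l).card < (I.classes x).card → I.lowerBound l ≤ countIn ts l

/-- Candidate `y` can be added for the benefit of label `x`. -/
structure IsAddition (I : Instance) (ts : List (Fin I.numCands)) (x : ℕ)
    (y : Fin I.numCands) : Prop where
  notMem : y ∉ ts
  mem_classes : y ∈ I.classes x
  upper : ∀ l ≤ I.numLabels, countIn (ts ++ [y]) l ≤ I.upperBound l

theorem toFinset_concat (ts : List (Fin I.numCands)) (y : Fin I.numCands) :
    (ts ++ [y]).toFinset = insert y ts.toFinset := by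
  ext
  simp

theorem isPartial_nil (I : Instance) : IsPartial I [] where
  nodup := List.nodup_nil
  upper := by simp [countIn]
  extends_of_nonempty h := ⟨_, h.choose_spec, by simp⟩

theorem countIn_of_gt {l : ℕ} (h : I.numLabels < l) (ts : List (Fin I.numCands)) :
    countIn ts l = 0 := by
  simp [countIn, classes_of_gt h]

/-- Serving a smallest deficient class is safe, by `exists_boundedSets_insert`. -/
theorem IsPartial.concat (hI : IsOneLaminar I.lab) {ts : List (Fin I.numCands)} {x : ℕ}
    {y : Fin I.numCands} (h : IsPartial I ts) (hx : IsDeficient I ts x)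
    (hy : IsAddition I ts x y) : IsPartial I (ts ++ [y]) := by
  have hnd : (ts ++ [y]).Nodup := by
    rw [List.nodup_append]
    refine ⟨h.nodup, List.nodup_singleton y, ?_⟩
    rintro a ha b hb rfl
    exact hy.notMem (List.mem_singleton.1 hb ▸ ha)
  refine ⟨hnd, hy.upper, fun hne => ?_⟩
  obtain ⟨S, hS, hsub⟩ := h.extends_of_nonempty hne
  rw [committees_eq_boundedSets] at hS ⊢
  rw [toFinset_concat]
  refine exists_boundedSets_insert (laminarFamily_classes hI) hS hsub (i := x)
    (by rw [← countIn_eq_card h.nodup]; exact hx.lt_lowerBound)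
    (fun j hj => by rw [← countIn_eq_card h.nodup]; exact hx.minimal j hj) hy.mem_classes
    (by simpa using hy.notMem) fun j => ?_
  rw [← toFinset_concat, ← countIn_eq_card hnd]
  rcases Nat.lt_or_ge I.numLabels j with hj | hj
  · simp [countIn_of_gt hj]
  · exact hy.upper j hj

/-- A committee extending the list meets the lower bound of `x`, so it has a further member in that
class; adding this member keeps all upper bounds, since the committee respects them. Hence a
fruitless search proves that there is no committee. -/
theorem IsPartial.exists_isAddition {ts : List (Fin I.numCands)} {x : ℕ}
    (h : IsPartial I ts) (hx : IsDeficient I ts x) (hne : I.committees.Nonempty) :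
    ∃ y, IsAddition I ts x y := by
  obtain ⟨S, hS, hsub⟩ := h.extends_of_nonempty hne
  rw [committees_eq_boundedSets] at hS
  have hlt := hx.lt_lowerBound
  rw [countIn_eq_card h.nodup] at hlt
  obtain ⟨y, hy, hy'⟩ := Finset.exists_mem_notMem_of_card_lt_card (hlt.trans_le (hS x).1)
  rw [Finset.mem_inter] at hy hy'
  have hyt : y ∉ ts := fun h => hy' ⟨by simpa using h, hy.2⟩
  refine ⟨y, hyt, hy.2, fun l _ => ?_⟩
  have hnd : (ts ++ [y]).Nodup := by
    rw [List.nodup_append]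
    refine ⟨h.nodup, List.nodup_singleton y, ?_⟩
    rintro a ha b hb rfl
    exact hyt (List.mem_singleton.1 hb ▸ ha)
  rw [countIn_eq_card hnd, toFinset_concat]
  exact (Finset.card_le_card (Finset.inter_subset_inter_right
    (Finset.insert_subset hy.1 hsub))).trans (hS l).2

end Instance

open Instance

variable {I : Instance} {wt : ℕ → ℝ} {s : Mem}

/-- Find a smallest deficient label: its number goes to register `13`, its count to
register `14`. -/
def pickLabel : Prog :=
  Prog.seqs [.assign 13 (.reg 1),
    .forRange 9 1 (.ite (.and (.lt (.get 7 (.reg 9)) (.get 2 (.reg 9)))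
      (.lt (.get 8 (.reg 9)) (.get 8 (.reg 13)))) (.assign 13 (.reg 9)) .skip),
    .assign 14 (.get 7 (.reg 13))]

/-- The search starts from the root, which is deficient because the list is still too short, and
moves to a deficient label only if its class is strictly smaller. The root need not be compared
again, as no class is larger. -/
theorem runs_pickLabel (hs : Ready I s) {ts : List (Fin I.numCands)}
    (hcnt : ∀ l ≤ I.numLabels, s.arr 7 l = countIn ts l)
    (hsize : ∀ l ≤ I.numLabels, s.arr 8 l = (I.classes l).card)
    (hlen : ts.length < I.size) :
    Runs wt pickLabel s (I.numLabels * 22 + 11) fun s' =>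
      ∃ x, s'.reg 13 = x ∧ s'.reg 14 = countIn ts x ∧ IsDeficient I ts x := by
  refine Runs.assign_seq (T' := I.numLabels * 22 + 9) ?_ (by simp only [Expr.cost]; omega)
  simp only [Expr.eval, hs.reg1]
  have hs₁ : Ready I (s.setReg 13 I.numLabels) := hs.setReg (by decide)
  refine Runs.seq (T₁ := I.numLabels * 22 + 6) (T₂ := 3) (Runs.forRange (fun i s' =>
    ∃ x ≤ I.numLabels, s'.reg 13 = x ∧ countIn ts x < I.lowerBound x ∧
      ∀ l < i, countIn ts l < I.lowerBound l → (I.classes x).card ≤ (I.classes l).card)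
    I.numLabels 14 ?_ hs₁.reg1 (by decide) (by decide) (by decide) ?_) ?_ le_rfl
  · exact ⟨_, le_rfl, by simp, by rwa [countIn_numLabels, lowerBound_numLabels], by simp⟩
  · rintro i s₂ hi hi9 hF ⟨x, hx, h13, hdef, hmin⟩
    have hs₂ : Ready I s₂ := hs₁.of_frame hF (by decide) (by decide)
    have e7 : s₂.arr 7 = s.arr 7 := hF.arr 7 (by decide)
    have e8 : s₂.arr 8 = s.arr 8 := hF.arr 8 (by decide)
    refine Runs.ite (T' := 2) (fun hb => Runs.assign (by simp [Expr.cost]) ?_)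
      (fun hb => Runs.skip (by simp) ?_) (by simp [Test.cost, Expr.cost])
    · simp only [Test.holds, Expr.eval, hi9, e7, e8, h13, hs₂.arr2, hcnt i hi.le, hsize i hi.le,
        hsize x hx] at hb
      refine ⟨i, hi.le, by simp [Expr.eval, hi9], hb.1, fun l hl hl' => ?_⟩
      rcases Nat.lt_succ_iff_lt_or_eq.1 hl with h | rfl
      · exact hb.2.le.trans (hmin l h hl')
      · exact le_rfl
    · simp only [Test.holds, Expr.eval, hi9, e7, e8, h13, hs₂.arr2, hcnt i hi.le, hsize i hi.le,
        hsize x hx] at hb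
      refine ⟨x, hx, by simpa using h13, hdef, fun l hl hl' => ?_⟩
      rcases Nat.lt_succ_iff_lt_or_eq.1 hl with h | rfl
      · exact hmin l h hl'
      · by_contra hcon
        exact hb ⟨hl', by omega⟩
  · rintro s₂ hF ⟨x, hx, h13, hdef, hmin⟩
    have e7 : s₂.arr 7 = s.arr 7 := hF.arr 7 (by decide)
    refine Runs.assign (by simp [Expr.cost]) ⟨x, by simpa using h13,
      by simp [Expr.eval, h13, e7, hcnt x hx], hx, hdef, fun l hl => ?_⟩
    by_contra! hcon
    rcases Nat.lt_trichotomy l I.numLabels with h | rfl | h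
    · exact absurd (hmin l h hcon) (by omega)
    · rw [classes_numLabels] at hl
      exact absurd (Finset.card_le_card (Finset.subset_univ (I.classes x))) (by omega)
    · rw [lowerBound_of_gt h] at hcon
      omega

/-- Try to add candidate `reg 17` to the list of length `reg 15` in array `6`. -/
def tryAddition : Prog :=
  Prog.seqs [.store 6 (.reg 15) (.reg 17), .assign 3 (.add (.reg 15) (.lit 1)),
    .assign 4 (.reg 17), countProg, checkUpper,
    .ite (.and (.eq (.reg 11) (.lit 1)) (.and (.eq (.reg 5) (.lit 1))
      (.lt (.reg 14) (.get 7 (.reg 13))))) (.assign 16 (.lit 1)) .skip]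

theorem runs_tryAddition (hs : Ready I s) {ts : List (Fin I.numCands)} {x U : ℕ}
    {y : Fin I.numCands} (h15 : s.reg 15 = ts.length) (h17 : s.reg 17 = y) (h13 : s.reg 13 = x)
    (h14 : s.reg 14 = countIn ts x) (hx : x ≤ I.numLabels) (h16 : s.reg 16 = 0)
    (hts : segment (s.arr 6) 0 ts.length = ts.map Fin.val)
    (hU : (ts.length + 2) * (I.numLabels + 1) ≤ U) :
    Runs wt tryAddition s (99 * U) fun s' =>
      segment (s'.arr 6) 0 (ts.length + 1) = (ts ++ [y]).map Fin.val ∧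
      ((s'.reg 16 = 1 ∧ IsAddition I ts x y) ∨ (s'.reg 16 = 0 ∧ ¬ IsAddition I ts x y)) := by
  have hU1 : I.numLabels + 1 ≤ U := le_trans (by nlinarith) hU
  have hU2 : (ts.length + 1 + 1) * (I.numLabels + 1) ≤ U := hU
  refine Runs.store_seq (Runs.assign_seq (Runs.assign_seq (T' := 99 * U - 9) ?_ le_rfl)
    le_rfl) (by simp only [Expr.cost]; omega)
  simp only [Expr.eval, Mem.setArr_reg, h15, h17,
    Mem.setReg_reg_of_ne _ _ (show 17 ≠ 3 by decide)]
  have hs₁ : Ready I (((s.setArr 6 ts.length y).setReg 3 (ts.length + 1)).setReg 4 y) :=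
    ((hs.setArr (by decide)).setReg (by decide)).setReg (by decide)
  have hseg : segment (Function.update (s.arr 6) ts.length y) 0 (ts.length + 1) =
      (ts ++ [y]).map Fin.val := by
    rw [segment_concat (Nat.zero_le _), segment_update_of_le _ _ le_rfl, hts]
    simp
  refine Runs.seq (runs_countProg hs₁ (zs := ts ++ [y]) (m := ts.length + 1) (by simp)
    (by simpa using hseg)) (T₂ := 17 * U + 23) ?_ (by omega)
  rintro s₂ hF₂ ⟨hcnt, hocc⟩
  have hs₂ : Ready I s₂ := hs₁.of_frame hF₂ (by decide) (by decide)
  refine Runs.seq (runs_checkUpper hs₂ hcnt) (T₂ := 15) ?_ (by omega)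
  intro s₃ hF₃ h11
  have e6 : s₃.arr 6 = Function.update (s.arr 6) ts.length y := by
    rw [hF₃.arr 6 (by decide), hF₂.arr 6 (by decide)]
    simp
  have e16 : s₃.reg 16 = 0 := by
    rw [hF₃.reg 16 (by decide), hF₂.reg 16 (by decide)]
    simp [h16]
  have e13 : s₃.reg 13 = x := by
    rw [hF₃.reg 13 (by decide), hF₂.reg 13 (by decide)]
    simp [h13]
  have e14 : s₃.reg 14 = countIn ts x := by
    rw [hF₃.reg 14 (by decide), hF₂.reg 14 (by decide)]
    simp [h14]
  have e5 : s₃.reg 5 = ts.count y + 1 := by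
    rw [hF₃.reg 5 (by decide), hocc, Mem.setReg_reg_self,
      List.count_map_of_injective _ _ Fin.val_injective]
    simp
  have e7 : s₃.arr 7 x = countIn ts x + if y ∈ I.classes x then 1 else 0 := by
    rw [hF₃.arr 7 (by decide), hcnt x hx, countIn, List.countP_append, List.countP_singleton]
    simp [countIn]
  -- A single occurrence of `y` after the insertion means that it was new, and an increased count
  -- for `x` means that `y` has label `x`.
  have key : (s₃.reg 11 = 1 ∧ s₃.reg 5 = 1 ∧ s₃.reg 14 < s₃.arr 7 (s₃.reg 13)) ↔
      IsAddition I ts x y := by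
    rw [e13, e14, e5, e7, h11]
    constructor
    · rintro ⟨h1, h2, h3⟩
      refine ⟨List.count_eq_zero.1 (by omega), ?_, h1⟩
      by_contra hcon
      simp [hcon] at h3
    · rintro ⟨h1, h2, h3⟩
      exact ⟨h3, by simp [List.count_eq_zero.2 h1], by simp [h2]⟩
  refine Runs.ite (T' := 2) (fun hb => Runs.assign (by simp [Expr.cost]) ⟨?_, Or.inl ⟨?_, ?_⟩⟩)
    (fun hb => Runs.skip (by simp) ⟨?_, Or.inr ⟨?_, ?_⟩⟩) (by simp [Test.cost, Expr.cost])
  · rw [Mem.setReg_arr, e6, hseg]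
  · simp [Expr.eval]
  · exact key.1 hb
  · rw [e6, hseg]
  · exact e16
  · exact fun h => hb (key.2 h)

/-- Look for a candidate that can be added to the list in array `6`; success is reported in
register `16`. -/
def searchAddition : Prog :=
  Prog.seqs [.assign 16 (.lit 0), .forRange 17 0 (.ite (.eq (.reg 16) (.lit 0)) tryAddition .skip)]

theorem runs_searchAddition (hs : Ready I s) {ts : List (Fin I.numCands)} {x U : ℕ}
    (h15 : s.reg 15 = ts.length) (h13 : s.reg 13 = x)
    (h14 : s.reg 14 = countIn ts x) (hx : x ≤ I.numLabels)
    (hts : segment (s.arr 6) 0 ts.length = ts.map Fin.val)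
    (hU : (ts.length + 2) * (I.numLabels + 1) ≤ U) :
    Runs wt searchAddition s (I.numCands * (111 * U) + 8) fun s' =>
      (s'.reg 16 = 1 ∧ ∃ y, IsAddition I ts x y ∧
        segment (s'.arr 6) 0 (ts.length + 1) = (ts ++ [y]).map Fin.val) ∨
      (s'.reg 16 = 0 ∧ ∀ y, ¬ IsAddition I ts x y) := by
  have hU1 : 1 ≤ U := le_trans (by nlinarith) hU
  refine Runs.assign_seq (T' := I.numCands * (111 * U) + 6) ?_ (by simp only [Expr.cost]; omega)
  simp only [Expr.eval]
  have hs₁ : Ready I (s.setReg 16 0) := hs.setReg (by decide)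
  refine (Runs.forRange (fun i s' => (s'.reg 16 = 1 ∧ ∃ y, IsAddition I ts x y ∧
        segment (s'.arr 6) 0 (ts.length + 1) = (ts ++ [y]).map Fin.val) ∨
      (s'.reg 16 = 0 ∧ segment (s'.arr 6) 0 ts.length = ts.map Fin.val ∧
        ∀ y : Fin I.numCands, y.1 < i → ¬ IsAddition I ts x y)) I.numCands (99 * U + 4)
    (Or.inr ⟨by simp, by simpa using hts, by simp⟩) hs₁.reg0 (by decide) (by decide) (by decide)
    ?_).conseq ?_ ?_
  · rintro i s₂ hi hi17 hF hI
    have hs₂ : Ready I s₂ := hs₁.of_frame hF (by decide) (by decide)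
    refine Runs.ite (T' := 99 * U) (fun hb => ?_) (fun hb => Runs.skip (by omega) ?_)
      (by simp only [Test.cost, Expr.cost]; omega)
    · simp only [Test.holds, Expr.eval] at hb
      obtain ⟨-, hseg, hno⟩ := hI.resolve_left fun h => by omega
      refine (runs_tryAddition hs₂ (y := ⟨i, hi⟩) (x := x) (U := U) ?_ hi17 ?_ ?_ hx hb hseg
        hU).conseq le_rfl ?_
      · rw [hF.reg 15 (by decide)]
        simp [h15]
      · rw [hF.reg 13 (by decide)]
        simp [h13]
      · rw [hF.reg 14 (by decide)]
        simp [h14]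
      · rintro s₃ - ⟨hseg', h⟩
        rcases h with ⟨h16, hadd⟩ | ⟨h16, hadd⟩
        · exact Or.inl ⟨by simpa using h16, _, hadd, by simpa using hseg'⟩
        · refine Or.inr ⟨by simpa using h16, ?_, fun y hy => ?_⟩
          -- A failed attempt overwrites only the slot after the list, so nothing has to be undone.
          · rw [segment_concat (Nat.zero_le _), List.map_append] at hseg'
            exact (List.append_inj hseg' (by simp)).1
          · rcases Nat.lt_succ_iff_lt_or_eq.1 hy with h | h
            · exact hno y h
            · obtain rfl : y = ⟨i, hi⟩ := Fin.ext h
              exact hadd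
    · simp only [Test.holds, Expr.eval] at hb
      exact Or.inl (by simpa using hI.resolve_right fun h => hb h.1)
  · have : I.numCands * (99 * U + 4 + 8) ≤ I.numCands * (111 * U) :=
      Nat.mul_le_mul_left _ (by omega)
    omega
  · rintro s₂ - h
    exact h.imp id fun h => ⟨h.1, fun y => h.2.2 y y.2⟩

/-- One round of the construction of a diverse committee. -/
def extendRound : Prog :=
  Prog.seqs [.assign 3 (.reg 15), countProg, pickLabel, searchAddition,
    .ite (.eq (.reg 16) (.lit 0)) (.assign 18 (.lit 0)) .skip]

theorem runs_extendRound (hI : IsOneLaminar I.lab) (hs : Ready I s)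
    (hsize : ∀ l ≤ I.numLabels, s.arr 8 l = (I.classes l).card)
    {ts : List (Fin I.numCands)} (h15 : s.reg 15 = ts.length) (h18 : s.reg 18 = 1)
    (hts : segment (s.arr 6) 0 ts.length = ts.map Fin.val) (hp : IsPartial I ts)
    (hlen : ts.length < I.size) {U : ℕ} (hU : (I.size + 1) * (I.numLabels + 1) = U) :
    Runs wt extendRound s (I.numCands * (111 * U) + 99 * U) fun s' =>
      (s'.reg 18 = 1 ∧ ∃ y, IsPartial I (ts ++ [y]) ∧
        segment (s'.arr 6) 0 (ts.length + 1) = (ts ++ [y]).map Fin.val) ∨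
      (s'.reg 18 = 0 ∧ I.committees = ∅) := by
  have hU1 : (ts.length + 2) * (I.numLabels + 1) ≤ U :=
    (Nat.mul_le_mul_right _ (by omega)).trans hU.le
  have hU2 : (ts.length + 1) * (I.numLabels + 1) ≤ U :=
    (Nat.mul_le_mul_right _ (by omega)).trans hU.le
  have hU3 : I.numLabels + 1 ≤ U := le_trans (by nlinarith) hU1
  refine Runs.assign_seq (T' := I.numCands * (111 * U) + 99 * U - 2) ?_
    (by simp only [Expr.cost]; omega)
  simp only [Expr.eval, h15]
  have hs₁ : Ready I (s.setReg 3 ts.length) := hs.setReg (by decide)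
  refine Runs.seq (runs_countProg hs₁ (zs := ts) (m := ts.length) (by simp) (by simpa using hts))
    (T₂ := I.numCands * (111 * U) + 49 * U - 2) ?_ (by omega)
  rintro s₂ hF₂ ⟨hcnt, -⟩
  have hs₂ : Ready I s₂ := hs₁.of_frame hF₂ (by decide) (by decide)
  refine Runs.seq (runs_pickLabel hs₂ hcnt (fun l hl => ?_) hlen)
    (T₂ := I.numCands * (111 * U) + 14) ?_ (by omega)
  · rw [hF₂.arr 8 (by decide)]
    exact hsize l hl
  rintro s₃ hF₃ ⟨x, h13, h14, hx⟩
  have hs₃ : Ready I s₃ := hs₂.of_frame hF₃ (by decide) (by decide)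
  refine Runs.seq (runs_searchAddition hs₃ (ts := ts) ?_ h13 h14 hx.le_numLabels ?_ hU1)
    (T₂ := 6) ?_ (by omega)
  · rw [hF₃.reg 15 (by decide), hF₂.reg 15 (by decide)]
    simp [h15]
  · rw [hF₃.arr 6 (by decide), hF₂.arr 6 (by decide)]
    simpa using hts
  intro s₄ hF₄ h
  have e18 : s₄.reg 18 = 1 := by
    rw [hF₄.reg 18 (by decide), hF₃.reg 18 (by decide), hF₂.reg 18 (by decide)]
    simp [h18]
  refine Runs.ite (T' := 2) (fun hb => Runs.assign (by simp [Expr.cost]) ?_)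
    (fun hb => Runs.skip (by simp) ?_) (by simp [Test.cost, Expr.cost])
  · simp only [Test.holds, Expr.eval] at hb
    obtain ⟨-, hno⟩ := h.resolve_left fun h => by omega
    refine Or.inr ⟨by simp [Expr.eval], Set.not_nonempty_iff_eq_empty.1 fun hne => ?_⟩
    obtain ⟨y, hy⟩ := hp.exists_isAddition hx hne
    exact hno y hy
  · simp only [Test.holds, Expr.eval] at hb
    obtain ⟨-, y, hy, hseg⟩ := h.resolve_right fun h => hb h.1
    exact Or.inl ⟨e18, y, hp.concat hI hx hy, hseg⟩

/-- Construct a diverse committee of the desired size in array `6`; register `18` tells whether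
there is one. -/
def buildCommittee : Prog :=
  Prog.seqs [.assign 18 (.lit 1), .forRange 15 2 (.ite (.eq (.reg 18) (.lit 1)) extendRound .skip),
    .ite (.eq (.reg 18) (.lit 1)) (Prog.seqs [.assign 3 (.reg 2), countProg, checkLower,
      .assign 18 (.reg 12)]) .skip]

theorem mem_committees_iff {zs : List (Fin I.numCands)} (h : zs.Nodup) :
    zs.toFinset ∈ I.committees ↔
      (∀ l ≤ I.numLabels, I.lowerBound l ≤ countIn zs l) ∧
        ∀ l ≤ I.numLabels, countIn zs l ≤ I.upperBound l := by
  rw [committees_eq_boundedSets, boundedSets, Set.mem_ofPred_eq]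
  simp only [← countIn_eq_card h]
  constructor
  · exact fun h => ⟨fun l _ => (h l).1, fun l _ => (h l).2⟩
  · rintro ⟨h1, h2⟩ l
    rcases Nat.lt_or_ge I.numLabels l with hl | hl
    · simp [countIn_of_gt hl, lowerBound_of_gt hl]
    · exact ⟨h1 l hl, h2 l hl⟩

theorem runs_buildCommittee (hI : IsOneLaminar I.lab) (hs : Ready I s)
    (hsize : ∀ l ≤ I.numLabels, s.arr 8 l = (I.classes l).card) {U : ℕ}
    (hU : (I.size + 1) * (I.numLabels + 1) = U) :
    Runs wt buildCommittee s (I.size * (I.numCands * (111 * U) + 111 * U) + 99 * U) fun s' =>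
      (s'.reg 18 = 1 ∧ ∃ zs : List (Fin I.numCands), zs.Nodup ∧ zs.toFinset ∈ I.committees ∧
        segment (s'.arr 6) 0 I.size = zs.map Fin.val) ∨
      (s'.reg 18 = 0 ∧ I.committees = ∅) := by
  have hU3 : I.numLabels + 1 ≤ U := le_trans (by nlinarith) hU.le
  refine Runs.assign_seq (T' := I.size * (I.numCands * (111 * U) + 111 * U) + 99 * U - 2) ?_
    (by simp only [Expr.cost]; omega)
  simp only [Expr.eval]
  have hs₁ : Ready I (s.setReg 18 1) := hs.setReg (by decide)
  refine Runs.seq (T₁ := I.size * (I.numCands * (111 * U) + 111 * U) + 6) (T₂ := 75 * U + 16)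
    ((Runs.forRange (fun i s' => (s'.reg 18 = 1 ∧ ∃ ts : List (Fin I.numCands), ts.length = i ∧
      IsPartial I ts ∧ segment (s'.arr 6) 0 i = ts.map Fin.val) ∨
      (s'.reg 18 = 0 ∧ I.committees = ∅)) I.size (I.numCands * (111 * U) + 99 * U + 4)
      (Or.inl ⟨by simp, [], rfl, isPartial_nil I, by simp⟩) hs₁.reg2 (by decide) (by decide)
      (by decide) ?_).conseq ?_ fun _ _ h => h) ?_ (by omega)
  · rintro i s₂ hi h15 hF h
    have hs₂ : Ready I s₂ := hs₁.of_frame hF (by decide) (by decide)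
    refine Runs.ite (T' := I.numCands * (111 * U) + 99 * U) (fun hb => ?_)
      (fun hb => Runs.skip (by omega) ?_) (by simp only [Test.cost, Expr.cost]; omega)
    · simp only [Test.holds, Expr.eval] at hb
      obtain ⟨-, ts, rfl, hp, hseg⟩ := h.resolve_right fun h => by omega
      refine (runs_extendRound hI hs₂ (fun l hl => ?_) h15 hb hseg hp hi hU).conseq le_rfl ?_
      · rw [hF.arr 8 (by decide)]
        exact hsize l hl
      · rintro s₃ - h
        refine h.imp ?_ (by simp)
        rintro ⟨h18, y, hp', hseg'⟩
        exact ⟨by simpa using h18, _, by simp, hp', by simpa using hseg'⟩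
    · simp only [Test.holds, Expr.eval] at hb
      exact Or.inr (by simpa using h.resolve_left fun h => hb h.1)
  · have : I.size * (I.numCands * (111 * U) + 99 * U + 4 + 8) ≤
        I.size * (I.numCands * (111 * U) + 111 * U) := Nat.mul_le_mul_left _ (by omega)
    omega
  intro s₂ hF₂ h
  have hs₂ : Ready I s₂ := hs₁.of_frame hF₂ (by decide) (by decide)
  refine Runs.ite (T' := 75 * U + 12) (fun hb => ?_)
      (fun hb => Runs.skip (by omega) ?_) (by simp only [Test.cost, Expr.cost]; omega)
  · simp only [Test.holds, Expr.eval] at hb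
    obtain ⟨-, ts, hlen, hp, hseg⟩ := h.resolve_right fun h => by omega
    refine Runs.assign_seq (T' := 75 * U + 10) ?_ (by simp only [Expr.cost]; omega)
    simp only [Expr.eval, hs₂.reg2]
    have hs₃ : Ready I (s₂.setReg 3 I.size) := hs₂.setReg (by decide)
    refine Runs.seq (runs_countProg hs₃ (zs := ts) (m := I.size) (by simp) (by simpa using hseg))
      (T₂ := 25 * U + 10) ?_ (by omega)
    rintro s₄ hF₄ ⟨hcnt, -⟩
    have hs₄ : Ready I s₄ := hs₃.of_frame hF₄ (by decide) (by decide)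
    refine Runs.seq (runs_checkLower hs₄ hcnt) (T₂ := 2) ?_ (by omega)
    rintro s₅ hF₅ ⟨h12, hlow⟩
    have e6 : s₅.arr 6 = s₂.arr 6 := by
      rw [hF₅.arr 6 (by decide), hF₄.arr 6 (by decide)]
      simp
    refine Runs.assign (by simp [Expr.cost]) ?_
    -- The construction guards only the upper bounds. If a committee exists, one contains the list
    -- and has the same size, so the lower bounds hold as well; a violated lower bound therefore
    -- proves that there is none.
    by_cases hl : ∀ l ≤ I.numLabels, I.lowerBound l ≤ countIn ts l
    · refine Or.inl ⟨by simpa [Expr.eval] using hlow.2 hl, ts, hp.nodup,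
        (mem_committees_iff hp.nodup).2 ⟨hl, hp.upper⟩, ?_⟩
      rw [Mem.setReg_arr, e6, hseg]
    · refine Or.inr ⟨?_, Set.not_nonempty_iff_eq_empty.1 fun hne => hl ?_⟩
      · simpa [Expr.eval] using h12.resolve_right fun h => hl (hlow.1 h)
      · obtain ⟨S, hS, hsub⟩ := hp.extends_of_nonempty hne
        have : ts.toFinset = S := Finset.eq_of_subset_of_card_le hsub
          (by rw [hS.2, List.toFinset_card_of_nodup hp.nodup, hlen])
        exact ((mem_committees_iff hp.nodup).1 (this ▸ hS)).1
  · simp only [Test.holds, Expr.eval] at hb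
    exact Or.inr (h.resolve_left fun h => hb h.1)

/-- Compute in array `8` the sizes of the label classes; array `4` must list all candidates. -/
def computeSizes : Prog :=
  Prog.seqs [Prog.copy 6 4 27 0, .assign 3 (.reg 0), countProg, Prog.copy 8 7 27 10]

theorem runs_computeSizes (hs : Ready I s) {os : List (Fin I.numCands)}
    (hos : segment (s.arr 4) 0 I.numCands = os.map Fin.val) (hnd : os.Nodup)
    (hall : ∀ c, c ∈ os) :
    Runs wt computeSizes s (100 * ((I.numCands + 1) * (I.numLabels + 1))) fun s' =>
      ∀ l ≤ I.numLabels, s'.arr 8 l = (I.classes l).card := by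
  refine Runs.seq (Runs.copy hs.reg0 (by decide) (by decide))
    (T₂ := 50 * ((I.numCands + 1) * (I.numLabels + 1)) + (I.numLabels + 1) * 12 + 8) ?_
    (by ring_nf; omega)
  intro s₁ hF₁ hcopy
  have hs₁ : Ready I s₁ := hs.of_frame hF₁ (by decide) (by decide)
  refine Runs.assign_seq
    (T' := 50 * ((I.numCands + 1) * (I.numLabels + 1)) + (I.numLabels + 1) * 12 + 6) ?_
    (by simp only [Expr.cost]; omega)
  simp only [Expr.eval, hs₁.reg0]
  have hs₂ : Ready I (s₁.setReg 3 I.numCands) := hs₁.setReg (by decide)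
  refine Runs.seq (runs_countProg hs₂ (zs := os) (m := I.numCands) (by simp) ?_)
    (T₂ := (I.numLabels + 1) * 12 + 6) ?_ (by omega)
  · rw [Mem.setReg_arr, segment_congr fun i _ hi => hcopy i hi, hos]
  rintro s₃ hF₃ ⟨hcnt, -⟩
  have hs₃ : Ready I s₃ := hs₂.of_frame hF₃ (by decide) (by decide)
  refine (Runs.copy hs₃.reg10 (by decide) (by decide)).conseq le_rfl fun s₄ _ h l hl => ?_
  rw [h l (by omega), hcnt l hl, countIn_eq_card hnd]
  congr 1
  ext c
  simp [hall c]

end DCWD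

namespace DCWD

/-! ### Running the greedy algorithm by replacing members of a complete committee -/

section Lists

variable {C : Type*} [DecidableEq C]

/-- Only the new entry can be repeated, so counting its occurrences is enough to detect a
repetition. -/
theorem nodup_set_iff {zs : List C} (h : zs.Nodup) {j : ℕ} (hj : j < zs.length) (c : C) :
    (zs.set j c).Nodup ↔ (zs.set j c).count c = 1 := by
  constructor
  · exact fun hu => List.count_eq_one_of_mem hu (List.mem_set hj c)
  · intro hu
    refine List.nodup_iff_count_le_one.2 fun a => ?_
    by_cases hac : a = c
    · exact hac ▸ hu.le
    · have := List.nodup_iff_count_le_one.1 h a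
      rw [List.count_set hj, if_neg (show ¬ (c == a) = true by simpa using Ne.symm hac)]
      omega

/-- A candidate that can be added to the first members of a basis can replace one of the others. -/
theorem HasExchange.exists_set [Fintype C] {K : Set (Finset C)} (hK : HasExchange K)
    {zs : List C} (hnd : zs.Nodup) (hzs : zs.toFinset ∈ K) {m : ℕ} {c : C} (hc : c ∉ zs.take m)
    (hcl : insert c (zs.take m).toFinset ∈ lowerExtension K) :
    ∃ j, m ≤ j ∧ j < zs.length ∧ (zs.set j c).Nodup ∧ (zs.set j c).toFinset ∈ K := by
  have hidx : ∀ x ∈ zs, x ∉ zs.take m → ∃ j, ∃ h : j < zs.length, m ≤ j ∧ zs[j] = x := by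
    intro x hx hxm
    obtain ⟨j, hj, rfl⟩ := List.getElem_of_mem hx
    refine ⟨j, hj, ?_, rfl⟩
    by_contra! hlt
    exact hxm (List.mem_take_iff_getElem.2 ⟨j, by omega, rfl⟩)
  -- If `c` is already a later member, replacing it by itself is the required exchange, so the
  -- program needs no separate case for it.
  by_cases hcz : c ∈ zs
  · obtain ⟨j, hj, hmj, rfl⟩ := hidx c hcz hc
    refine ⟨j, hmj, hj, ?_⟩
    rw [List.set_getElem_self]
    exact ⟨hnd, hzs⟩
  · have hsub : (zs.take m).toFinset ⊆ zs.toFinset := by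
      intro x hx
      rw [List.mem_toFinset] at hx ⊢
      exact List.mem_of_mem_take hx
    obtain ⟨x, hx, hxm, hswap⟩ := hK.exists_swap hzs hsub (by simpa using hcz) hcl
    obtain ⟨j, hj, hmj, rfl⟩ := hidx x (by simpa using hx) (by simpa using hxm)
    refine ⟨j, hmj, hj, hnd.set hcz, ?_⟩
    rw [List.toFinset_eq_of_perm _ _ (List.set_perm_cons_eraseIdx hj c), List.toFinset_cons]
    have he : (zs.eraseIdx j).toFinset = zs.toFinset.erase zs[j] := by
      ext a
      rw [List.mem_toFinset, ← hnd.erase_getElem j hj, hnd.mem_erase_iff, Finset.mem_erase,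
        List.mem_toFinset]
    rwa [he]

end Lists

theorem segment_update (f : ℕ → ℕ) (i v k : ℕ) :
    segment (Function.update f i v) 0 k = (segment f 0 k).set i v := by
  refine List.ext_getElem (by simp) fun j h1 h2 => ?_
  rw [List.getElem_set]
  simp only [segment, List.getElem_map, List.getElem_range', Function.update_apply]
  simp [eq_comm]

theorem eq_getElem_of_segment {f : ℕ → ℕ} {k i : ℕ} {l : List ℕ} (h : segment f 0 k = l)
    (hi : i < l.length) : f i = l[i] := by
  subst h
  simp [segment]

open Instance

variable {I : Instance} {wt : ℕ → ℝ} {s : Mem}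

/-- Try to replace the member with index `reg 17` of the committee in array `6` by the
candidate `reg 4`; in case of success the latter is moved to index `reg 15`. -/
def trySwap : Prog :=
  Prog.seqs [.assign 28 (.get 6 (.reg 17)), .store 6 (.reg 17) (.reg 4), countProg, checkUpper,
    checkLower,
    .ite (.and (.eq (.reg 5) (.lit 1)) (.and (.eq (.reg 11) (.lit 1)) (.eq (.reg 12) (.lit 1))))
      (Prog.seqs [.assign 16 (.lit 1), .store 6 (.reg 17) (.get 6 (.reg 15)),
        .store 6 (.reg 15) (.reg 4)])
      (.store 6 (.reg 17) (.reg 28))]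

/-- Array `6` lists a diverse committee that arises from `zs` by making `c` its member with
index `m`, without changing the first `m` members. -/
def Accepted (I : Instance) (zs : List (Fin I.numCands)) (m : ℕ) (c : Fin I.numCands)
    (s : Mem) : Prop :=
  ∃ zs' : List (Fin I.numCands), zs'.Nodup ∧ zs'.toFinset ∈ I.committees ∧
    segment (s.arr 6) 0 I.size = zs'.map Fin.val ∧ zs'.take (m + 1) = zs.take m ++ [c]

theorem runs_trySwap (hs : Ready I s) {zs : List (Fin I.numCands)} {j m U : ℕ}
    {c : Fin I.numCands} (h3 : s.reg 3 = I.size) (h4 : s.reg 4 = c) (h15 : s.reg 15 = m)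
    (h16 : s.reg 16 = 0) (h17 : s.reg 17 = j) (hmj : m ≤ j) (hj : j < I.size) (hnd : zs.Nodup)
    (hseg : segment (s.arr 6) 0 I.size = zs.map Fin.val)
    (hU : (I.size + 1) * (I.numLabels + 1) = U) :
    Runs wt trySwap s (127 * U) fun s' =>
      (s'.reg 16 = 1 ∧ Accepted I zs m c s') ∨
      (s'.reg 16 = 0 ∧ segment (s'.arr 6) 0 I.size = zs.map Fin.val ∧
        ¬ ((zs.set j c).Nodup ∧ (zs.set j c).toFinset ∈ I.committees)) := by
  have hU3 : I.numLabels + 1 ≤ U := le_trans (by nlinarith) hU.le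
  have hlen : zs.length = I.size := by simpa using (congrArg List.length hseg).symm
  refine Runs.assign_seq (Runs.store_seq (T' := 127 * U - 6) ?_ le_rfl)
    (by simp only [Expr.cost]; omega)
  simp only [Expr.eval, h17, h4,
    Mem.setReg_reg_of_ne _ _ (show 17 ≠ 28 by decide),
    Mem.setReg_reg_of_ne _ _ (show 4 ≠ 28 by decide)]
  have hx : s.arr 6 j = (zs[j]'(by omega) : Fin I.numCands) := by
    rw [eq_getElem_of_segment hseg (by simpa using hlen ▸ hj)]
    simp
  have hs₁ : Ready I ((s.setReg 28 (s.arr 6 j)).setArr 6 j c) :=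
    (hs.setReg (by decide)).setArr (by decide)
  have hset : segment (Function.update (s.arr 6) j c) 0 I.size = (zs.set j c).map Fin.val := by
    rw [segment_update, hseg, List.map_set]
  refine Runs.seq (runs_countProg hs₁ (zs := zs.set j c) (m := I.size) (by simpa using h3)
    (by simpa using hset)) (T₂ := 77 * U - 6) ?_ (by omega)
  rintro s₂ hF₂ ⟨hcnt, hocc⟩
  have hs₂ : Ready I s₂ := hs₁.of_frame hF₂ (by decide) (by decide)
  refine Runs.seq (runs_checkUpper hs₂ hcnt) (T₂ := 60 * U - 14) ?_ (by omega)
  intro s₃ hF₃ h11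
  have hs₃ : Ready I s₃ := hs₂.of_frame hF₃ (by decide) (by decide)
  refine Runs.seq (runs_checkLower (f := countIn (zs.set j c)) hs₃ fun l hl => ?_)
    (T₂ := 21) ?_ (by omega)
  · rw [hF₃.arr 7 (by decide)]
    exact hcnt l hl
  rintro s₄ hF₄ ⟨-, h12⟩
  have e6 : s₄.arr 6 = Function.update (s.arr 6) j c := by
    rw [hF₄.arr 6 (by decide), hF₃.arr 6 (by decide), hF₂.arr 6 (by decide)]
    simp
  have ereg : ∀ r ∈ [4, 15, 16, 17, 28], s₄.reg r = (s.setReg 28 (s.arr 6 j)).reg r := by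
    intro r hr
    have h1 : r ∉ checkLower.regs := by revert r; decide
    have h2 : r ∉ checkUpper.regs := by revert r; decide
    have h3 : r ∉ countProg.regs := by revert r; decide
    rw [hF₄.reg r h1, hF₃.reg r h2, hF₂.reg r h3]
    rfl
  have e4 : s₄.reg 4 = c := by rw [ereg 4 (by decide)]; simpa using h4
  have e15 : s₄.reg 15 = m := by rw [ereg 15 (by decide)]; simpa using h15
  have e16 : s₄.reg 16 = 0 := by rw [ereg 16 (by decide)]; simpa using h16
  have e17 : s₄.reg 17 = j := by rw [ereg 17 (by decide)]; simpa using h17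
  have e28 : s₄.reg 28 = (zs[j]'(by omega) : Fin I.numCands) := by
    rw [ereg 28 (by decide)]
    simpa using hx
  -- The three flags together decide whether the modified list is again a diverse committee without
  -- repetition.
  have key : (s₄.reg 5 = 1 ∧ s₄.reg 11 = 1 ∧ s₄.reg 12 = 1) ↔
      ((zs.set j c).Nodup ∧ (zs.set j c).toFinset ∈ I.committees) := by
    have e5 : s₄.reg 5 = (zs.set j c).count c := by
      rw [hF₄.reg 5 (by decide), hF₃.reg 5 (by decide), hocc]
      simp only [Mem.setArr_reg, Mem.setReg_reg_of_ne _ _ (show 4 ≠ 28 by decide), h4]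
      exact List.count_map_of_injective _ _ Fin.val_injective _
    rw [e5, h12, hF₄.reg 11 (by decide), h11, nodup_set_iff hnd (by omega)]
    refine and_congr_right fun h => ?_
    rw [mem_committees_iff ((nodup_set_iff hnd (by omega) c).2 h), and_comm]
  refine Runs.ite (T' := 9) (fun hb => ?_) (fun hb => Runs.store (by simp [Expr.cost]) ?_)
    (by simp [Test.cost, Expr.cost])
  · obtain ⟨hnd', hmem'⟩ := key.1 hb
    refine Runs.assign_seq (Runs.store_seq (Runs.store (T := 3) (by simp [Expr.cost]) ?_) le_rfl)
      (by simp [Expr.cost])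
    refine Or.inl ⟨by simp [Expr.eval], ?_⟩
    obtain ⟨u, hu⟩ : ∃ u, u = zs.set j c := ⟨_, rfl⟩
    rw [← hu] at hset hnd' hmem'
    have hul : u.length = I.size := by simp [hu, hlen]
    have huj : u[j]'(by omega) = c := by simp [hu]
    have hum : Function.update (s.arr 6) j c m = (u[m]'(by omega) : Fin I.numCands) := by
      rw [eq_getElem_of_segment hset (by simp; omega)]
      simp
    -- Moving `c` to index `m` exchanges two entries of the new list, so its underlying set is
    -- unchanged, and the first `m` entries are not touched because `m ≤ j`.
    have hperm := List.set_set_perm (as := u) (i := j) (j := m) (by omega) (by omega)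
    rw [huj] at hperm
    refine ⟨(u.set j (u[m]'(by omega))).set m c, hperm.nodup_iff.2 hnd', ?_, ?_, ?_⟩
    · rwa [List.toFinset_eq_of_perm _ _ hperm]
    · simp only [Expr.eval, Mem.setArr_reg, Mem.setReg_arr, Mem.setArr_arr_self,
        Mem.setReg_reg_of_ne _ _ (show 15 ≠ 16 by decide),
        Mem.setReg_reg_of_ne _ _ (show 17 ≠ 16 by decide),
        Mem.setReg_reg_of_ne _ _ (show 4 ≠ 16 by decide), e15, e17, e4, e6, hum]
      rw [segment_update, segment_update, hset, List.map_set, List.map_set]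
    · rw [List.take_succ_eq_append_getElem (by simp; omega), List.getElem_set_self,
        List.take_set_of_le le_rfl, List.take_set_of_le hmj, hu, List.take_set_of_le hmj]
  · refine Or.inr ⟨e16, ?_, fun h => hb (key.2 h)⟩
    simp only [Expr.eval, e17, e28, Mem.setArr_arr_self, e6]
    rw [segment_update, hset, ← List.map_set, List.set_set, List.set_getElem_self]

/-- Process candidate number `reg 19` in array `4`. -/
def processCandidate : Prog :=
  Prog.seqs [.assign 4 (.get 4 (.reg 19)), .assign 16 (.lit 0), .assign 17 (.reg 15),
    .forLoop 17 2 (.ite (.eq (.reg 16) (.lit 0)) trySwap .skip),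
    .assign 15 (.add (.reg 15) (.reg 16))]

theorem runs_processCandidate (hs : Ready I s) {zs : List (Fin I.numCands)} {m U : ℕ}
    {c : Fin I.numCands} (h3 : s.reg 3 = I.size) (hc : s.arr 4 (s.reg 19) = c)
    (h15 : s.reg 15 = m) (hm : m ≤ I.size) (hnd : zs.Nodup)
    (hseg : segment (s.arr 6) 0 I.size = zs.map Fin.val)
    (hU : (I.size + 1) * (I.numLabels + 1) = U) :
    Runs wt processCandidate s (I.size * (139 * U) + 15) fun s' =>
      (s'.reg 15 = m + 1 ∧ m < I.size ∧ Accepted I zs m c s') ∨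
      (s'.reg 15 = m ∧ segment (s'.arr 6) 0 I.size = zs.map Fin.val ∧
        ∀ j, m ≤ j → j < I.size →
          ¬ ((zs.set j c).Nodup ∧ (zs.set j c).toFinset ∈ I.committees)) := by
  have hU3 : 1 ≤ U := le_trans (by nlinarith) hU.le
  refine Runs.assign_seq (Runs.assign_seq (Runs.assign_seq (T' := I.size * (139 * U) + 8) ?_
    le_rfl) le_rfl) (by simp only [Expr.cost]; omega)
  simp only [Expr.eval, hc, Mem.setReg_reg_of_ne _ _ (show 15 ≠ 16 by decide),
    Mem.setReg_reg_of_ne _ _ (show 15 ≠ 4 by decide), h15]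
  have hs₁ : Ready I (((s.setReg 4 c).setReg 16 0).setReg 17 m) :=
    ((hs.setReg (by decide)).setReg (by decide)).setReg (by decide)
  refine Runs.seq (Runs.forLoop (fun i s' => (s'.reg 16 = 1 ∧ m < I.size ∧ Accepted I zs m c s') ∨
      (s'.reg 16 = 0 ∧ segment (s'.arr 6) 0 I.size = zs.map Fin.val ∧
        ∀ j, m ≤ j → j < i → ¬ ((zs.set j c).Nodup ∧ (zs.set j c).toFinset ∈ I.committees)))
      I.size (127 * U + 4) ?_ (by simpa using hm) hs₁.reg2 (by decide) (by decide) (by decide) ?_)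
      (T₂ := 4) ?_ ?_
  · refine Or.inr ⟨by simp, by simpa using hseg, fun j hj hj' => ?_⟩
    rw [Mem.setReg_reg_self] at hj'
    omega
  · intro j s₂ hj hjk h17 hF h
    rw [Mem.setReg_reg_self] at hj
    have hs₂ : Ready I s₂ := hs₁.of_frame hF (by decide) (by decide)
    refine Runs.ite (T' := 127 * U) (fun hb => ?_) (fun hb => Runs.skip (by omega) ?_)
      (by simp only [Test.cost, Expr.cost]; omega)
    · simp only [Test.holds, Expr.eval] at hb
      obtain ⟨-, hseg', hno⟩ := h.resolve_left fun h => by omega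
      refine (runs_trySwap hs₂ (c := c) (m := m) (zs := zs) ?_ ?_ ?_ hb h17 hj hjk hnd hseg'
        hU).conseq le_rfl fun s₃ _ h => ?_
      · rw [hF.reg 3 (by decide)]
        simpa using h3
      · rw [hF.reg 4 (by decide)]
        simp
      · rw [hF.reg 15 (by decide)]
        simpa using h15
      · rcases h with ⟨h16, ha⟩ | ⟨h16, hseg'', hno'⟩
        · exact Or.inl ⟨by simpa using h16, by omega, ha⟩
        · refine Or.inr ⟨by simpa using h16, by simpa using hseg'', fun i hi hij => ?_⟩
          rcases Nat.lt_succ_iff_lt_or_eq.1 hij with h | rfl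
          · exact hno i hi h
          · exact hno'
    · simp only [Test.holds, Expr.eval] at hb
      have h' := h.resolve_right fun h => hb h.1
      exact Or.inl ⟨by simpa using h'.1, h'.2.1, h'.2.2⟩
  · rintro s₂ hF ⟨h, -⟩
    have e15 : s₂.reg 15 = m := by
      rw [hF.reg 15 (by decide)]
      simpa using h15
    refine Runs.assign (by simp [Expr.cost]) ?_
    rcases h with ⟨h16, hmk, ha⟩ | ⟨h16, hseg', hno⟩
    · exact Or.inl ⟨by simp [Expr.eval, e15, h16], hmk, ha⟩
    · exact Or.inr ⟨by simp [Expr.eval, e15, h16], hseg', hno⟩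
  · simp only [Mem.setReg_reg_self]
    have : (I.size - m) * (127 * U + 4 + 8) ≤ I.size * (139 * U) :=
      Nat.mul_le_mul (by omega) (by omega)
    omega

/-- Run the greedy algorithm on the candidates in the order of array `4`, keeping in array `6` a
diverse committee that starts with the chosen candidates. -/
def greedyPass : Prog :=
  Prog.seqs [.assign 3 (.reg 2), .assign 15 (.lit 0), .forRange 19 0 processCandidate]

theorem runs_greedyPass (hI : IsOneLaminar I.lab) (hs : Ready I s)
    {os zs : List (Fin I.numCands)} (hos : segment (s.arr 4) 0 I.numCands = os.map Fin.val)
    (hond : os.Nodup) (hall : ∀ c, c ∈ os)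
    (hsort : os.Pairwise fun a b => I.weight b ≤ I.weight a)
    (hnd : zs.Nodup) (hmem : zs.toFinset ∈ I.committees)
    (hseg : segment (s.arr 6) 0 I.size = zs.map Fin.val) {U : ℕ}
    (hU : (I.size + 1) * (I.numLabels + 1) = U) :
    Runs wt greedyPass s (I.numCands * (I.size * (139 * U) + 23) + 10) fun s' =>
      ∃ ys : List (Fin I.numCands), segment (s'.arr 6) 0 I.size = ys.map Fin.val ∧
        IsGreedyRun I.committees I.obj ys ∧
        IsWinningCommittee I.spec I.size I.obj ys.toFinset := by
  have hK : HasExchange I.committees := hI.hasExchange _ _ _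
  have hne : I.committees.Nonempty := ⟨_, hmem⟩
  have hol : os.length = I.numCands := by simpa using (congrArg List.length hos).symm
  refine Runs.assign_seq (Runs.assign_seq
    (T' := I.numCands * (I.size * (139 * U) + 23) + 6) ?_ le_rfl) (by simp only [Expr.cost]; omega)
  simp only [Expr.eval, hs.reg2]
  have hs₁ : Ready I ((s.setReg 3 I.size).setReg 15 0) :=
    (hs.setReg (by decide)).setReg (by decide)
  -- Invariant after `q` candidates: `zs` is a committee, its first `m` members form a greedy run
  -- among the candidates seen, and every other candidate seen cannot be added to them.
  refine (Runs.forRange (fun q s' => ∃ (zs : List (Fin I.numCands)) (m : ℕ), s'.reg 15 = m ∧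
    m ≤ I.size ∧ zs.Nodup ∧ zs.toFinset ∈ I.committees ∧
    segment (s'.arr 6) 0 I.size = zs.map Fin.val ∧
    IsGreedyRun I.committees I.obj (zs.take m) ∧ (∀ c ∈ zs.take m, c ∈ os.take q) ∧
    ∀ c ∈ os.take q, c ∈ zs.take m ∨
      insert c (zs.take m).toFinset ∉ lowerExtension I.committees)
    I.numCands (I.size * (139 * U) + 15) ?_ hs₁.reg0 (by decide) (by decide) (by decide)
    ?_).conseq le_rfl ?_
  · exact ⟨zs, 0, by simp, by simp, hnd, hmem, by simpa using hseg,
      by simpa using isGreedyRun_nil _ _, by simp, by simp⟩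
  · rintro q s₂ hq h19 hF ⟨zs, m, h15, hm, hnd, hmem, hseg, hrun, hsub, hrej⟩
    have hs₂ : Ready I s₂ := hs₁.of_frame hF (by decide) (by decide)
    have hqo : q < os.length := by omega
    obtain ⟨c, hc⟩ : ∃ c, c = os[q] := ⟨_, rfl⟩
    have htake : os.take (q + 1) = os.take q ++ [c] := by
      rw [List.take_succ_eq_append_getElem hqo, hc]
    have hsplit : os = os.take q ++ c :: os.drop (q + 1) := by
      rw [hc, ← List.drop_eq_getElem_cons hqo, List.take_append_drop]
    have hcq : c ∉ os.take q := by
      intro h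
      obtain ⟨i, hi, h⟩ := List.mem_take_iff_getElem.1 h
      rw [hc, hond.getElem_inj_iff] at h
      omega
    have hlen : zs.length = I.size := by simpa using (congrArg List.length hseg).symm
    refine (runs_processCandidate hs₂ (c := c) (m := m) (zs := zs) ?_ ?_ h15 hm hnd hseg
      hU).conseq le_rfl ?_
    · rw [hF.reg 3 (by decide)]
      simp
    · rw [hF.arr 4 (by decide), h19, hc]
      simp only [Mem.setReg_arr]
      rw [eq_getElem_of_segment hos (by simpa using hqo)]
      simp
    rintro s₃ - (⟨h15', hmk, zs', hnd', hmem', hseg', htk⟩ | ⟨h15', hseg', hno⟩)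
    · have htf : (zs'.take (m + 1)).toFinset = insert c (zs.take m).toFinset := by
        rw [htk, toFinset_concat]
      refine ⟨zs', m + 1, by simpa using h15', hmk, hnd', hmem', by simpa using hseg', ?_, ?_, ?_⟩
      · rw [htk]
        refine hrun.concat (fun x => hsplit ▸ hall x) (hsplit ▸ hsort) hrej
          (fun h => hcq (hsub c h)) ⟨_, hmem', ?_⟩
        rw [← htf]
        intro x hx
        rw [List.mem_toFinset] at hx ⊢
        exact List.mem_of_mem_take hx
      · intro x hx
        rw [htk, List.mem_append] at hx
        rw [htake, List.mem_append]
        exact hx.imp_left (hsub x)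
      · intro x hx
        rw [htake, List.mem_append] at hx
        rw [htf, htk, List.mem_append]
        rcases hx with hx | hx
        -- The lower extension is closed downward, so what could not be added to the smaller set
        -- cannot be added to the larger one.
        · refine (hrej x hx).imp Or.inl fun h h' => h (lowerExtension_mono h' ?_)
          exact Finset.insert_subset_insert _ (Finset.subset_insert _ _)
        · exact Or.inl (Or.inr hx)
    · refine ⟨zs, m, by simpa using h15', hm, hnd, hmem, by simpa using hseg', hrun, ?_, ?_⟩
      · intro x hx
        rw [htake, List.mem_append]
        exact Or.inl (hsub x hx)
      · intro x hx
        rw [htake, List.mem_append, List.mem_singleton] at hx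
        rcases hx with hx | rfl
        · exact hrej x hx
        · refine Or.inr fun hcl => ?_
          obtain ⟨j, hmj, hj, h⟩ := hK.exists_set hnd hmem (fun h => hcq (hsub x h)) hcl
          exact hno j hmj (by omega) h
  · rintro s₂ - ⟨zs, m, -, hm, hnd, hmem, hseg, hrun, -, hrej⟩
    have hlen : zs.length = I.size := by simpa using (congrArg List.length hseg).symm
    -- Otherwise the member with index `m` could be added to the choices, although all candidates
    -- have been processed.
    have hmk : m = I.size := by
      by_contra hcon
      have hml : m < zs.length := by omega
      rw [List.take_of_length_le hol.le] at hrej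
      rcases hrej zs[m] (hall _) with h | h
      · obtain ⟨i, hi, h⟩ := List.mem_take_iff_getElem.1 h
        rw [hnd.getElem_inj_iff] at h
        omega
      · refine h ⟨_, hmem, Finset.insert_subset (by simp) fun x hx => ?_⟩
        rw [List.mem_toFinset] at hx ⊢
        exact List.mem_of_mem_take hx
    rw [hmk, ← hlen, List.take_length] at hrun
    exact ⟨zs, hseg, hrun, hrun.isWinningCommittee hK hne hlen⟩

end DCWD

namespace DCWD

/-! ### The complete algorithm -/

open Instance

variable {I : Instance} {wt : ℕ → ℝ} {s : Mem}

/-- For the case without labels: every initial part of the sorted list lies in the committee of the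
first `k`, so no candidate is ever rejected. -/
theorem isGreedyRun_take_of_pairwise {C : Type*} [Fintype C] [DecidableEq C]
    {K : Set (Finset C)} {w : C → ℝ} {os : List C} (hnd : os.Nodup) (hall : ∀ c, c ∈ os)
    (hsort : os.Pairwise fun a b => w b ≤ w a) {k : ℕ} (hK : (os.take k).toFinset ∈ K) :
    IsGreedyRun K (separable w) (os.take k) := by
  suffices H : ∀ i ≤ k, IsGreedyRun K (separable w) (os.take i) from H k le_rfl
  intro i
  induction i with
  | zero => exact fun _ => by simpa using isGreedyRun_nil K (separable w)
  | succ i ih =>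
    intro hi
    rcases Nat.lt_or_ge i os.length with hlt | hge
    · have hsplit : os = os.take i ++ os[i] :: os.drop (i + 1) := by
        rw [← List.drop_eq_getElem_cons hlt, List.take_append_drop]
      rw [List.take_succ_eq_append_getElem hlt]
      refine (ih (by omega)).concat (fun c => hsplit ▸ hall c) (hsplit ▸ hsort)
        (fun c hc => Or.inl hc) ?_ ⟨_, hK, ?_⟩
      · intro h
        obtain ⟨j, hj, h⟩ := List.mem_take_iff_getElem.1 h
        rw [hnd.getElem_inj_iff] at h
        omega
      · intro x hx
        have hx' : x ∈ os.take (i + 1) := by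
          rw [List.take_succ_eq_append_getElem hlt, List.mem_append, List.mem_singleton]
          rw [Finset.mem_insert, List.mem_toFinset] at hx
          exact hx.symm
        exact List.mem_toFinset.2 ((List.take_subset_take_left os hi) hx')
    · have := ih (by omega)
      rw [List.take_of_length_le hge] at this
      rw [List.take_of_length_le (by omega)]
      exact this

/-- The part of the algorithm for instances with labels, after sorting. -/
def labelledProg : Prog :=
  Prog.seqs [.assign 10 (.add (.reg 1) (.lit 1)), .store 2 (.reg 1) (.reg 2),
    .store 3 (.reg 1) (.reg 2), computeSizes, buildCommittee,
    .ite (.eq (.reg 18) (.lit 1))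
      (Prog.seqs [greedyPass, Prog.copy 0 6 27 2, .assign 0 (.lit 1)]) (.assign 0 (.lit 0))]

/-- The algorithm. -/
def greedyProg : Prog :=
  .ite (.lt (.reg 0) (.reg 2)) (.assign 0 (.lit 0))
    (.seq mergeSort (.ite (.eq (.reg 1) (.lit 0))
      (Prog.seqs [Prog.copy 0 4 27 2, .assign 0 (.lit 1)]) labelledProg))

theorem Instance.weightArray_val (c : Fin I.numCands) : I.weightArray c = I.weight c := by
  simp [weightArray]

theorem exists_candidates_of_perm {l : List ℕ} (hp : l.Perm (List.range I.numCands))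
    (hw : l.Pairwise fun a b => I.weightArray b ≤ I.weightArray a) :
    ∃ os : List (Fin I.numCands), l = os.map Fin.val ∧ os.Nodup ∧ (∀ c, c ∈ os) ∧
      os.Pairwise fun a b => I.weight b ≤ I.weight a := by
  obtain ⟨os, rfl⟩ : ∃ os : List (Fin I.numCands), l = os.map Fin.val :=
    ⟨l.pmap Fin.mk fun a ha => by simpa using hp.subset ha, by simp [List.map_pmap]⟩
  refine ⟨os, rfl, ?_, fun c => ?_, ?_⟩
  · exact List.Nodup.of_map _ (hp.nodup_iff.2 List.nodup_range)
  · have : c.1 ∈ os.map Fin.val := hp.symm.subset (by simp)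
    simpa [Fin.val_inj] using this
  · simpa [List.pairwise_map, weightArray_val] using hw

/-- The memory from which the input without the size bounds can be read off. -/
structure Unchanged (I : Instance) (s : Mem) : Prop where
  reg0 : s.reg 0 = I.numCands
  reg1 : s.reg 1 = I.numLabels
  reg2 : s.reg 2 = I.size
  arr : ∀ a < 4, s.arr a = I.initMem.arr a

/-- The three preparatory writes put the root into the slot just after the bounds of the last label;
all later slots read as `0`. -/
theorem Unchanged.ready (h : Unchanged I s) :
    Ready I (((s.setReg 10 (I.numLabels + 1)).setArr 2 I.numLabels I.size).setArr 3
      I.numLabels I.size) where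
  reg0 := by simp [h.reg0]
  reg1 := by simp [h.reg1]
  reg2 := by simp [h.reg2]
  reg10 := by simp
  arr0 := by simp [h.arr 0]
  arr1 := by simp [h.arr 1]
  arr2 := by
    funext l
    rw [Mem.setArr_arr_of_ne _ _ _ (by decide), Mem.setArr_arr]
    rcases Nat.lt_trichotomy l I.numLabels with hl | rfl | hl
    · simp [h.arr 2, initMem, inputArray, lowerBound, hl, hl.ne]
    · simp [lowerBound]
    · simp [h.arr 2, initMem, inputArray, lowerBound, hl.ne', not_lt.2 hl.le]
  arr3 := by
    funext l
    rw [Mem.setArr_arr]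
    rcases Nat.lt_trichotomy l I.numLabels with hl | rfl | hl
    · simp [h.arr 3, initMem, inputArray, upperBound, hl, hl.ne]
    · simp [upperBound]
    · simp [h.arr 3, initMem, inputArray, upperBound, hl.ne', not_lt.2 hl.le]

theorem runs_labelledProg (hI : IsOneLaminar I.lab) (hs : Unchanged I s)
    {os : List (Fin I.numCands)} (hos : segment (s.arr 4) 0 I.numCands = os.map Fin.val)
    (hond : os.Nodup) (hall : ∀ c, c ∈ os)
    (hsort : os.Pairwise fun a b => I.weight b ≤ I.weight a) {U : ℕ}
    (hU : (I.size + 1) * (I.numLabels + 1) = U) :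
    Runs wt labelledProg s (100 * ((I.numCands + 1) * (I.numLabels + 1)) +
      (I.size * (I.numCands * (111 * U) + 111 * U) + 99 * U) +
      (I.numCands * (I.size * (139 * U) + 23) + 10) + I.size * 12 + 22) I.CorrectAnswer := by
  have hs₁ := hs.ready
  refine Runs.assign_seq (Runs.store_seq (Runs.store_seq
    (T' := 100 * ((I.numCands + 1) * (I.numLabels + 1)) +
      (I.size * (I.numCands * (111 * U) + 111 * U) + 99 * U) +
      (I.numCands * (I.size * (139 * U) + 23) + 10) + I.size * 12 + 12) ?_ le_rfl) le_rfl)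
    (by simp only [Expr.cost]; omega)
  simp only [Expr.eval, Mem.setArr_reg, hs.reg1, hs.reg2,
    Mem.setReg_reg_of_ne _ _ (show 1 ≠ 10 by decide),
    Mem.setReg_reg_of_ne _ _ (show 2 ≠ 10 by decide)]
  refine Runs.seq (runs_computeSizes hs₁ (os := os) (by simpa using hos) hond hall)
    (T₂ := (I.size * (I.numCands * (111 * U) + 111 * U) + 99 * U) +
      (I.numCands * (I.size * (139 * U) + 23) + 10) + I.size * 12 + 12) ?_ (by omega)
  intro s₂ hF₂ hsize
  have hs₂ : Ready I s₂ := hs₁.of_frame hF₂ (by decide) (by decide)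
  refine Runs.seq (runs_buildCommittee hI hs₂ hsize hU)
    (T₂ := (I.numCands * (I.size * (139 * U) + 23) + 10) + I.size * 12 + 12) ?_ (by omega)
  intro s₃ hF₃ h
  have hs₃ : Ready I s₃ := hs₂.of_frame hF₃ (by decide) (by decide)
  refine Runs.ite (T' := (I.numCands * (I.size * (139 * U) + 23) + 10) + I.size * 12 + 8)
    (fun hb => ?_) (fun hb => Runs.assign (by simp only [Expr.cost]; omega) ?_)
    (by simp only [Test.cost, Expr.cost]; omega)
  · simp only [Test.holds, Expr.eval] at hb
    obtain ⟨-, zs, hnd, hmem, hseg⟩ := h.resolve_right fun h => by omega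
    refine Runs.seq (runs_greedyPass hI hs₃ (os := os) ?_ hond hall hsort hnd hmem hseg hU)
      (T₂ := I.size * 12 + 8) ?_ (by omega)
    · rw [hF₃.arr 4 (by decide), hF₂.arr 4 (by decide)]
      simpa using hos
    rintro s₄ hF₄ ⟨ys, hys, hrun, hwin⟩
    have hs₄ : Ready I s₄ := hs₃.of_frame hF₄ (by decide) (by decide)
    refine Runs.seq (Runs.copy hs₄.reg2 (by decide) (by decide)) (T₂ := 2) ?_ (by omega)
    intro s₅ _ hcopy
    refine Runs.assign (by simp [Expr.cost]) (Or.inr ⟨by simp [Expr.eval], ys, ?_, hrun, hwin⟩)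
    rw [Mem.setReg_arr, ← segment_zero, segment_congr fun i _ hi => hcopy i hi, hys]
  · simp only [Test.holds, Expr.eval] at hb
    exact Or.inl ⟨(h.resolve_left fun h => hb h.1).2, by simp [Expr.eval]⟩

/-- The bound for the running time of merge sort. -/
def sortTime (n : ℕ) : ℕ := (n * 80 + 20) * Nat.clog 2 n + n * 11 + 12

/-- The three alternatives for `T` follow the branches: too few candidates, no labels, and the
general case. They are kept apart because only the last is charged for the trials. -/
theorem runs_greedyProg (hI : IsOneLaminar I.lab) {T : ℕ}
    (hT : (I.numCands < I.size ∧ 6 ≤ T) ∨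
      (I.size ≤ I.numCands ∧ I.numLabels = 0 ∧ sortTime I.numCands + I.size * 12 + 16 ≤ T) ∨
      (I.size ≤ I.numCands ∧ I.numLabels ≠ 0 ∧ ∃ U, (I.size + 1) * (I.numLabels + 1) = U ∧
        sortTime I.numCands + (100 * ((I.numCands + 1) * (I.numLabels + 1)) +
          (I.size * (I.numCands * (111 * U) + 111 * U) + 99 * U) +
          (I.numCands * (I.size * (139 * U) + 23) + 10) + I.size * 12 + 22) + 8 ≤ T)) :
    Runs I.weightArray greedyProg I.initMem T I.CorrectAnswer := by
  have hT6 : 6 ≤ T := by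
    rcases hT with h | h | ⟨-, -, U, -, h⟩ <;> omega
  have h0 : I.initMem.reg 0 = I.numCands := rfl
  have h1 : I.initMem.reg 1 = I.numLabels := rfl
  have h2 : I.initMem.reg 2 = I.size := rfl
  refine Runs.ite (T' := T - 4) (fun hb => ?_) (fun hb => ?_)
    (by simp only [Test.cost, Expr.cost]; omega)
  · simp only [Test.holds, Expr.eval, h0, h2] at hb
    refine Runs.assign (by simp only [Expr.cost]; omega) (Or.inl ⟨?_, by simp [Expr.eval]⟩)
    refine Set.eq_empty_of_forall_notMem fun S hS => ?_
    have := Finset.card_le_univ S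
    rw [hS.2, Fintype.card_fin] at this
    omega
  · simp only [Test.holds, Expr.eval, h0, h2] at hb
    have hT' := hT.resolve_left fun h => hb h.1
    have hsT : sortTime I.numCands + 16 ≤ T := by
      rcases hT' with h | ⟨-, -, U, -, h⟩ <;> omega
    refine Runs.seq (runs_mergeSort h0) (T₂ := T - 4 - sortTime I.numCands) ?_
      (by simp only [sortTime] at *; omega)
    rintro s₁ hF₁ ⟨hsorted, hperm⟩
    obtain ⟨os, hos, hond, hall, hsort⟩ := exists_candidates_of_perm hperm hsorted
    have hs₁ : Unchanged I s₁ := by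
      refine ⟨hF₁.reg 0 (by decide), hF₁.reg 1 (by decide), hF₁.reg 2 (by decide),
        fun a ha => hF₁.arr a ?_⟩
      revert a
      decide
    have hol : os.length = I.numCands := by simpa using (congrArg List.length hos).symm
    refine Runs.ite (T' := T - 8 - sortTime I.numCands) (fun hb' => ?_) (fun hb' => ?_)
      (by simp only [Test.cost, Expr.cost]; omega)
    · simp only [Test.holds, Expr.eval, hs₁.reg1] at hb'
      obtain ⟨-, -, hT'⟩ := hT'.resolve_right fun h => h.2.1 hb'
      refine Runs.seq (Runs.copy hs₁.reg2 (by decide) (by decide)) (T₂ := 2) ?_ (by omega)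
      intro s₂ _ hcopy
      have hmem : (os.take I.size).toFinset ∈ I.committees := by
        refine ⟨fun l => absurd l.2 (by omega), ?_⟩
        rw [List.toFinset_card_of_nodup (hond.sublist (List.take_sublist _ _)), List.length_take]
        omega
      have hrun := isGreedyRun_take_of_pairwise hond hall hsort hmem
      refine Runs.assign (by simp [Expr.cost]) (Or.inr ⟨by simp [Expr.eval], os.take I.size, ?_,
        hrun, hrun.isWinningCommittee (hI.hasExchange _ _ _) ⟨_, hmem⟩ (by simp; omega)⟩)
      rw [Mem.setReg_arr, ← segment_zero, segment_congr fun i _ hi => hcopy i hi, List.map_take,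
        ← hos, ← segment_append (Nat.zero_le I.size) (not_lt.1 hb), List.take_left' (by simp)]
    · simp only [Test.holds, Expr.eval, hs₁.reg1] at hb'
      obtain ⟨-, -, U, hU, hT'⟩ := hT'.resolve_left fun h => hb' h.2.1
      exact (runs_labelledProg hI hs₁ hos hond hall hsort hU).conseq (by omega) fun _ _ h => h

/-! ### Estimates for the running time -/

theorem natCast_le_mul_log (n : ℕ) : (n : ℝ) ≤ 2 * (n * Real.log n) + 1 := by
  rcases Nat.lt_or_ge n 2 with h | h
  · have h1 : (n : ℝ) ≤ 1 := by exact_mod_cast (by omega : n ≤ 1)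
    have h2 : 0 ≤ (n : ℝ) * Real.log n :=
      mul_nonneg (Nat.cast_nonneg n) (Real.log_natCast_nonneg n)
    linarith
  · have h1 : Real.log 2 ≤ Real.log n := Real.log_le_log (by norm_num) (by exact_mod_cast h)
    -- As `log 2 > 1/2`, the factor `2` suffices from `n = 2` on; the summand `1` takes care of `n =
    -- 1`, where the logarithm vanishes.
    have h2 := Real.log_two_gt_d9
    have h3 : (0 : ℝ) ≤ n := Nat.cast_nonneg n
    nlinarith

/-- For `n ≥ 2`, rounding up costs at most `1 ≤ log n / log 2`, and `2 / log 2 < 3`. -/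
theorem mul_clog_le_mul_log (n : ℕ) : ((n * Nat.clog 2 n : ℕ) : ℝ) ≤ 3 * (n * Real.log n) := by
  rcases Nat.lt_or_ge n 2 with h | h
  · have : Nat.clog 2 n = 0 := Nat.clog_of_right_le_one (by omega) 2
    rw [this, mul_zero, Nat.cast_zero]
    exact mul_nonneg (by norm_num) (mul_nonneg (Nat.cast_nonneg n) (Real.log_natCast_nonneg n))
  · have h1 : Real.log 2 ≤ Real.log n := Real.log_le_log (by norm_num) (by exact_mod_cast h)
    have h2 := Real.log_two_gt_d9
    have h4 : (Nat.clog 2 n : ℝ) ≤ Real.logb 2 n + 1 := by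
      have h5 := Real.natCeil_logb_natCast 2 n
      have h6 : (0 : ℝ) ≤ Real.logb 2 n :=
        Real.logb_nonneg (by norm_num) (by exact_mod_cast (by omega : 1 ≤ n))
      have h7 := (Nat.ceil_lt_add_one h6).le
      rw [← h5]
      exact_mod_cast h7
    have h5 : Real.logb 2 n + 1 ≤ 3 * Real.log n := by
      rw [Real.logb, div_add_one (by linarith), div_le_iff₀ (by linarith)]
      nlinarith
    push_cast
    have h3 : (0 : ℝ) ≤ n := Nat.cast_nonneg n
    nlinarith

theorem sortTime_le (n : ℕ) : (sortTime n : ℝ) ≤ 400 * (n * Real.log n) + 30 := by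
  have h1 := natCast_le_mul_log n
  have h2 := mul_clog_le_mul_log n
  have h3 : sortTime n ≤ 100 * (n * Nat.clog 2 n) + n * 11 + 12 := by
    rcases Nat.eq_zero_or_pos n with rfl | hn
    · simp [sortTime]
    · rw [sortTime, ← mul_assoc]
      gcongr
      omega
  have h4 : (sortTime n : ℝ) ≤ 100 * ((n * Nat.clog 2 n : ℕ) : ℝ) + n * 11 + 12 := by
    exact_mod_cast h3
  have h5 : 0 ≤ (n : ℝ) * Real.log n :=
    mul_nonneg (Nat.cast_nonneg n) (Real.log_natCast_nonneg n)
  linarith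

/-- With `1 ≤ k ≤ n` and `1 ≤ l`, every term is at most a multiple of `k ^ 2 * n * l`, using `U ≤ 4
* (k * l)`. For `k = 0` this fails, since counting the class sizes still takes time of order `n *
l`. -/
theorem labelled_time_le {n k l U : ℕ} (hk : 1 ≤ k) (hkn : k ≤ n) (hl : 1 ≤ l)
    (hU : (k + 1) * (l + 1) = U) :
    100 * ((n + 1) * (l + 1)) + (k * (n * (111 * U) + 111 * U) + 99 * U) +
      (n * (k * (139 * U) + 23) + 10) + k * 12 + 22 ≤ 2500 * (k ^ 2 * n * l) := by
  have hU' : U ≤ 4 * (k * l) := by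
    rw [← hU]
    nlinarith
  have hn : 1 ≤ n := hk.trans hkn
  have hkl : 1 ≤ k * l := Nat.mul_pos hk hl
  have hP : ∀ a b, a ≤ k ^ 2 → b ≤ n → a * b * l ≤ k ^ 2 * n * l := fun a b ha hb =>
    Nat.mul_le_mul_right _ (Nat.mul_le_mul ha hb)
  have hk2 : 1 ≤ k ^ 2 := Nat.one_le_pow _ _ hk
  have hkk : k ≤ k ^ 2 := Nat.le_self_pow (by norm_num) k
  have h1 : (n + 1) * (l + 1) ≤ 4 * (k ^ 2 * n * l) := by
    have := hP 1 n hk2 le_rfl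
    nlinarith
  have h2 : k * n * U ≤ 4 * (k ^ 2 * n * l) := by
    calc k * n * U ≤ k * n * (4 * (k * l)) := Nat.mul_le_mul_left _ hU'
      _ = 4 * (k ^ 2 * n * l) := by ring
  have h3 : k * U ≤ 4 * (k ^ 2 * n * l) := by
    refine le_trans ?_ h2
    rw [mul_right_comm]
    exact Nat.le_mul_of_pos_right _ hn
  have h4 : U ≤ 4 * (k ^ 2 * n * l) := (Nat.le_mul_of_pos_left _ hk).trans h3
  have h5 : n ≤ k ^ 2 * n * l := by
    refine (Nat.le_mul_of_pos_left n hk2).trans (Nat.le_mul_of_pos_right _ hl)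
  have h6 : k * (n * (111 * U) + 111 * U) = 111 * (k * n * U) + 111 * (k * U) := by ring
  have h7 : n * (k * (139 * U) + 23) = 139 * (k * n * U) + 23 * n := by ring
  rw [h6, h7]
  omega

end DCWD

theorem mainTheorem3 :
    -- the lower extension is a matroid, and the greedy algorithm finds a winning committee
    (∀ (C L : Type*) [Fintype C] [DecidableEq C] [Fintype L] [DecidableEq L]
        (lab : C → Finset L) (b₁ b₂ : L → ℕ) (k : ℕ) (w : C → ℝ),
      DCWD.IsOneLaminar lab →
      (DCWD.diverseCommittees (DCWD.intervalSpec lab b₁ b₂) k).Nonempty →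
        (∃ M : Matroid C, M.E = Set.univ ∧ ∀ T : Finset C,
          M.Indep (T : Set C) ↔
            T ∈ DCWD.lowerExtension (DCWD.diverseCommittees (DCWD.intervalSpec lab b₁ b₂) k)) ∧
        ∀ ys : List C,
          DCWD.IsGreedyRun (DCWD.diverseCommittees (DCWD.intervalSpec lab b₁ b₂) k)
            (DCWD.separable w) ys →
          (ys.length < k → ∃ y : C,
            DCWD.IsGreedyChoice (DCWD.diverseCommittees (DCWD.intervalSpec lab b₁ b₂) k)
              (DCWD.separable w) ys.toFinset y) ∧
          (ys.length = k →
            DCWD.IsWinningCommittee (DCWD.intervalSpec lab b₁ b₂) k (DCWD.separable w)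
              ys.toFinset)) ∧
    -- it can be implemented to run in time `O(k² |C| |L| + |C| log |C|)`
    (∃ (P : DCWD.Prog) (c : ℝ), ∀ I : DCWD.Instance, DCWD.IsOneLaminar I.lab →
      ∃ (s : DCWD.Mem) (t : ℕ),
        DCWD.Exec I.weightArray P I.initMem s t ∧ I.CorrectAnswer s ∧
        (1 ≤ I.size →
          (t : ℝ) ≤ c * ((I.size : ℝ) ^ 2 * I.numCands * I.numLabels +
            I.numCands * Real.log I.numCands + 1))) := by
  -- A generous constant: the labelled part needs `2500`, sorting `400`, and the additive terms are
  -- small.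
  refine ⟨?_, DCWD.greedyProg, 4000, fun I hI => ?_⟩
  · intro C L _ _ _ _ lab b₁ b₂ k w hlam hne
    have hK := hlam.hasExchange b₁ b₂ k
    obtain ⟨M, hE, -, hM⟩ := hK.exists_matroid hne
    exact ⟨⟨M, hE, hM⟩, fun ys hys =>
      ⟨fun h => hys.exists_choice hne h, fun h => hys.isWinningCommittee hK hne h⟩⟩
  have hlog : 0 ≤ (I.numCands : ℝ) * Real.log I.numCands :=
    mul_nonneg (Nat.cast_nonneg _) (Real.log_natCast_nonneg _)
  have hpos : 0 ≤ (I.size : ℝ) ^ 2 * I.numCands * I.numLabels := by positivity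
  have hsort := DCWD.sortTime_le I.numCands
  obtain ⟨T, hT, hTle⟩ : ∃ T : ℕ, DCWD.Runs I.weightArray DCWD.greedyProg I.initMem T
      I.CorrectAnswer ∧ (1 ≤ I.size → (T : ℝ) ≤ 4000 *
        ((I.size : ℝ) ^ 2 * I.numCands * I.numLabels + I.numCands * Real.log I.numCands + 1)) := by
    rcases Nat.lt_or_ge I.numCands I.size with hlt | hle
    · refine ⟨_, DCWD.runs_greedyProg hI (Or.inl ⟨hlt, le_rfl⟩), fun _ => ?_⟩
      push_cast
      linarith
    rcases Nat.eq_zero_or_pos I.numLabels with h0 | h0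
    · refine ⟨_, DCWD.runs_greedyProg hI (Or.inr (Or.inl ⟨hle, h0, le_rfl⟩)), fun _ => ?_⟩
      have h1 : (I.size : ℝ) ≤ I.numCands := by exact_mod_cast hle
      have h2 := DCWD.natCast_le_mul_log I.numCands
      push_cast
      linarith
    · refine ⟨_, DCWD.runs_greedyProg hI (Or.inr (Or.inr ⟨hle, h0.ne', _, rfl, le_rfl⟩)),
        fun hk => ?_⟩
      have h1 := DCWD.labelled_time_le hk hle h0 rfl
      rw [Nat.cast_add, Nat.cast_add]
      have h2 := (Nat.cast_le (α := ℝ)).2 h1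
      rw [Nat.cast_mul, Nat.cast_mul, Nat.cast_mul, Nat.cast_pow] at h2
      push_cast at h2 ⊢
      linarith
  obtain ⟨s, t, hexec, ht, hs⟩ := hT
  exact ⟨s, t, hexec, hs, fun hk => le_trans (by exact_mod_cast ht) (hTle hk)⟩
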